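/- Let $(\mathbb X,\mathcal X)$ be a Borel space with a localising ring $\mathcal X_0\subset\mathcal X$, that is, a ring of measurable sets such that $B\cap C\in\mathcal X_0$ for $B\in\mathcal X_0$, $C\in\mathcal X$, and such that there are $B_1\subset B_2\subset\cdots$ in $\mathcal X_0$ with union $\mathbb X$ for which each set in $\mathcal X_0$ is of the form $C\cap B_n$ with $C\in\mathcal X$, $n\in\mathbb N$. Let $\mathbf N$ be the set of all measures $\mu$ on $\mathbb X$ with $\mu(B)\in\{0,1,2,\dots\}$ for all $B\in\mathcal X_0$, equipped with the smallest $\sigma$-field making all maps $\mu\mapsto\mu(B)$, $B\in\mathcal X$, measurable; write $\mu'\le\mu$ if $\mu'(B)\le\mu(B)$ for all $B\in\mathcal X$, and $\mu_B:=\mu(\cdot\cap B)$. Let $\partial:\mathbf N\to\mathbf N$ be a generator, that is, a measurable map satisfying (H1) $\partial\mu\le\mu$ for all $\mu\in\mathbf N$; (H2) $\partial(\mu+\delta_x)=\partial\mu+\delta_x$ for all $\mu\in\mathbf N$ and all $x$ with $\partial\mu(\{x\})>0$; (H3) $\partial(\partial\mu+\mu')=\partial\mu$ for all $\mu,\mu'\in\mathbf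 N$ with $\mu'\le\mu-\partial\mu$; (H4) if $\mu'\le\mu$ and $\partial\mu=\partial\mu'$, then $\partial(\mu+\psi)=\partial(\mu'+\psi)$ for all $\psi\in\mathbf N$. Define the hull $[\mu]:=\{x\in\mathbb X:\partial(\mu+\delta_x)=\partial\mu\}$. For $\mathbf x=(x_1,\dots,x_n)\in\mathbb X^n$ put $\delta_{\mathbf x}:=\delta_{x_1}+\dots+\delta_{x_n}$ and $[\mathbf x]:=[\delta_{\mathbf x}]$, and let $C_n:=\{\mathbf x\in\mathbb X^n:\partial\delta_{\mathbf x}=\delta_{\mathbf x}\}$. Let $\lambda$ be a measure on $\mathbb X$ that is finite on $\mathcal X_0$, and let $\eta$ be a Poisson process with intensity measure $\lambda$, defined on a probability space $(\Omega,\mathcal F,\mathbb P)$. Write $\Pi_\nu$ for the distribution (on $\mathbf N$) of a Poisson process with intensity measure $\nu$. Then for each integer $n\ge 0$ and each measurable $A\subset\mathbf N\times\mathbf N$, $$\mathbb P\big(\partial\eta(\mathbb X)=n,\ (\partial\eta,\eta_{[\eta]})\in A\big)=\frac1{n!}\,\mathbb E\int_{C_n}\mathbf 1\{(\delta_{\mathbf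 x},\eta_{[\mathbf x]})\in A\}\,\exp\big[-\lambda([\mathbf x]^c)\big]\,\lambda^n(d\mathbf x),$$ where $\exp[-\infty]:=0$ and, for $n=0$, $\lambda^0$ is the unit mass at the empty tuple and $\delta_{\mathbf x}$ is the zero measure. If moreover $\partial\eta$ is almost surely finite (i.e. $\partial\eta(\mathbb X)<\infty$ a.s.), then for each measurable $A\subset\mathbf N$, $$\mathbb P\big(\eta_{[\eta]}\in A\mid\partial\eta\big)=\Pi_{\lambda_{[\eta]}}(A)\qquad\mathbb P\text{-a.s.}$$ -/

import Mathlib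

open MeasureTheory ProbabilityTheory
open scoped ENNReal

noncomputable section

/-- A localising ring on a measurable space `X`: a ring `sets` of measurable sets, stable under
intersection with measurable sets, and possessing an increasing exhausting sequence `B n` in `sets`
such that every member of `sets` has the form `C ∩ B n` with `C` measurable. -/
structure LocalisingRing (X : Type*) [MeasurableSpace X] where
  /-- The members of the ring. -/
  sets : Set (Set X)
  isSetRing : IsSetRing sets
  measurableSet : ∀ B ∈ sets, MeasurableSet B
  inter_mem : ∀ B ∈ sets, ∀ C : Set X, MeasurableSet C → B ∩ C ∈ sets
  exists_seq : ∃ B : ℕ → Set X, (∀ n, B n ∈ sets) ∧ Monotone B ∧ (⋃ n, B n) = Set.univ ∧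
    ∀ A ∈ sets, ∃ C : Set X, ∃ n : ℕ, MeasurableSet C ∧ A = C ∩ B n

section

variable {X : Type*} [MeasurableSpace X]

/-- A measure is locally finite (with respect to a localising ring) if it is finite on the ring. -/
def IsLocFinite (R : LocalisingRing X) (ν : Measure X) : Prop :=
  ∀ B ∈ R.sets, ν B < ∞

/-- The space `N` of all measures on `X` that take values in `{0, 1, 2, …}` on the localising ring.
Being a subtype of `Measure X`, it carries the pointwise (setwise) order and the smallest
`σ`-algebra for which all evaluations `μ ↦ μ B`, `B` measurable, are measurable. -/
abbrev CountingMeasure (R : LocalisingRing X) : Type _ :=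
  {μ : Measure X // ∀ B ∈ R.sets, ∃ k : ℕ, μ B = k}

namespace CountingMeasure

variable {R : LocalisingRing X}

/-- The sum of two counting measures. -/
instance instAdd : Add (CountingMeasure R) where
  add μ ν := ⟨μ.1 + ν.1, fun B hB => by
    obtain ⟨k, hk⟩ := μ.2 B hB
    obtain ⟨l, hl⟩ := ν.2 B hB
    exact ⟨k + l, by simp [hk, hl]⟩⟩

variable (R) in
/-- `δ_{x₁} + ⋯ + δ_{xₙ}` for an `n`-tuple `x` of points. -/
def diracSum {n : ℕ} (x : Fin n → X) : CountingMeasure R :=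
  ⟨∑ i, Measure.dirac (x i), fun B hB => by
    classical
    refine ⟨∑ i, if x i ∈ B then 1 else 0, ?_⟩
    simp only [Measure.coe_finsetSum, Finset.sum_apply,
      Measure.dirac_apply' _ (R.measurableSet B hB), Set.indicator_apply, Pi.one_apply]
    push_cast
    rfl⟩

variable (R) in
/-- The Dirac measure `δ_x`. -/
def dirac (x : X) : CountingMeasure R :=
  ⟨Measure.dirac x, fun B hB => by
    classical
    refine ⟨if x ∈ B then 1 else 0, ?_⟩
    rw [Measure.dirac_apply' _ (R.measurableSet B hB), Set.indicator_apply]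
    split_ifs <;> simp⟩

/-- The restriction `μ_s = μ(· ∩ s)`. -/
def restrict (μ : CountingMeasure R) (s : Set X) : CountingMeasure R :=
  ⟨μ.1.restrict s, fun B hB => by
    rw [Measure.restrict_apply (R.measurableSet B hB)]
    have h : μ.1 (B ∩ s) = μ.1 (B ∩ toMeasurable μ.1 (B ∩ s)) := by
      apply le_antisymm
      · exact measure_mono fun y hy => ⟨hy.1, subset_toMeasurable _ _ hy⟩
      · calc μ.1 (B ∩ toMeasurable μ.1 (B ∩ s)) ≤ μ.1 (toMeasurable μ.1 (B ∩ s)) :=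
            measure_mono Set.inter_subset_right
          _ = μ.1 (B ∩ s) := measure_toMeasurable _
    rw [h]
    exact μ.2 _ (R.inter_mem B hB _ (measurableSet_toMeasurable _ _))⟩

end CountingMeasure

variable {R : LocalisingRing X}

/-- A generator: a measurable map `D : N → N` satisfying the four properties (H1)–(H4).
The condition `D μ + μ' ≤ μ` in (H3) says `μ' ≤ μ - D μ`. -/
structure IsGenerator (D : CountingMeasure R → CountingMeasure R) : Prop where
  measurable : Measurable D
  /-- (H1) -/
  thinning : ∀ μ, D μ ≤ μ
  /-- (H2) -/
  additivity : ∀ μ, ∀ x : X, 0 < (D μ).1 {x} →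
    D (μ + CountingMeasure.dirac R x) = D μ + CountingMeasure.dirac R x
  /-- (H3) -/
  idempotency : ∀ μ μ', D μ + μ' ≤ μ → D (D μ + μ') = D μ
  /-- (H4) -/
  consistency : ∀ μ μ', μ' ≤ μ → D μ = D μ' → ∀ ψ, D (μ + ψ) = D (μ' + ψ)

/-- The hull `[μ] = {x : ∂(μ + δ_x) = ∂μ}` associated with a map `D = ∂ : N → N`. -/
def hull (D : CountingMeasure R → CountingMeasure R) (μ : CountingMeasure R) : Set X :=
  {x | D (μ + CountingMeasure.dirac R x) = D μ}

/-- The set `C_n` of all `n`-tuples `x` with `∂(δ_{x₁} + ⋯ + δ_{xₙ}) = δ_{x₁} + ⋯ + δ_{xₙ}`. -/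
def fixedTuples (D : CountingMeasure R → CountingMeasure R) (n : ℕ) : Set (Fin n → X) :=
  {x | D (CountingMeasure.diracSum R x) = CountingMeasure.diracSum R x}

/-- `exp(-a)` for `a ∈ [0, ∞]`, with `exp(-∞) = 0`. -/
def expNeg (a : ℝ≥0∞) : ℝ≥0∞ :=
  EReal.exp (-(a : EReal))

/-- `η` is a Poisson process with intensity measure `ν`: a point process (random element of `N`)
such that `η(B)` has the Poisson distribution with parameter `ν(B) ∈ [0, ∞]` (if `ν(B) = ∞`, all
the probabilities below are `0`, so that `η(B) = ∞` almost surely), and the values on pairwise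
disjoint sets are independent. -/
structure IsPoissonProcess {Ω : Type*} [MeasurableSpace Ω] (P : Measure Ω)
    (ν : Measure X) (η : Ω → CountingMeasure R) : Prop where
  measurable : Measurable η
  prob_eq : ∀ B : Set X, MeasurableSet B → ∀ k : ℕ,
    P {ω | (η ω).1 B = k} = expNeg (ν B) * ν B ^ k / (k.factorial : ℝ≥0∞)
  indep : ∀ (m : ℕ) (B : Fin m → Set X), (∀ i, MeasurableSet (B i)) →
    Pairwise (fun i j => Disjoint (B i) (B j)) →
    iIndepFun (fun (i : Fin m) (ω : Ω) => (η ω).1 (B i)) P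

variable (R) in
open Classical in
/-- `Π_ν`, the distribution on `N` of a Poisson process with intensity measure `ν`. For locally
finite `ν` on a Borel space there is exactly one such law; the value `0` is used where there is
none. -/
def poissonLaw (ν : Measure X) : Measure (CountingMeasure R) :=
  if h : ∃ Q : Measure (CountingMeasure R), IsProbabilityMeasure Q ∧ IsPoissonProcess Q ν id
  then h.choose else 0

end

end

/-! ### Exhaustion by the ring and arithmetic of counting measures. -/

section

variable {X : Type*} [MeasurableSpace X]

/-! The probabilistic engine is the Mecke equation (`lintegral_lintegral_eq`). Iterated over `n`
points, it rewrites `n!` times the left side as an integral over tuples `x` of the probability that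
`∂(η + δ_x)` has `n` points, contains `δ_x`, and lies with its hull restriction in `A`; the factor
`n!` counts the orderings of the selected points (`lintegral_lintegral_diracSum_le`).

Equal finite mass forces `∂(η + δ_x) = δ_x`. The deterministic core `apply_add_eq_iff` says that
this happens exactly when `∂` fixes `δ_x` and `η` has no point outside `[x]`; then the points of `η
+ δ_x` in its hull are those of `η` in `[x]` (`restrict_hull_add`). For fixed `x`, the parts of `η`
inside and outside `[x]` are independent, and the void probability of the outside is the exponential
factor (`prob_compl_eq_zero_inter`). This gives the first formula.

The formula shows that, given `∂η = δ_x`, the points in the hull are distributed as a Poisson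
process restricted to the fixed set `[x]`. Summing over `n`, which exhausts the probability when
`∂η` is a.s. finite, and using `[∂η] = [η]` (`hull_apply`) yields the conditional law
(`setLIntegral_prob_restrict_hull`). -/

theorem LocalisingRing.exists_disjoint_cover (R : LocalisingRing X) :
    ∃ E : ℕ → Set X, (∀ n, E n ∈ R.sets) ∧ Pairwise (fun i j => Disjoint (E i) (E j)) ∧
      (⋃ n, E n) = Set.univ := by
  obtain ⟨B, hB, hmono, hU, -⟩ := R.exists_seq
  refine ⟨disjointed B, fun n => ?_, disjoint_disjointed B, by rw [iUnion_disjointed, hU]⟩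
  have h : disjointed B n = B n ∩ disjointed B n :=
    (Set.inter_eq_right.2 (disjointed_subset B n)).symm
  rw [h]
  exact R.inter_mem _ (hB n) _ (MeasurableSet.disjointed (fun i => R.measurableSet _ (hB i)) n)

theorem LocalisingRing.singleton_mem [MeasurableSingletonClass X] (R : LocalisingRing X) (y : X) :
    {y} ∈ R.sets := by
  obtain ⟨E, hE, -, hU⟩ := R.exists_disjoint_cover
  obtain ⟨n, hn⟩ := Set.mem_iUnion.1 (hU ▸ Set.mem_univ y : y ∈ ⋃ n, E n)
  have := R.inter_mem _ (hE n) {y} (measurableSet_singleton y)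
  rwa [Set.inter_eq_right.2 (Set.singleton_subset_iff.2 hn)] at this

theorem IsLocFinite.sigmaFinite {R : LocalisingRing X} {ν : Measure X} (h : IsLocFinite R ν) :
    SigmaFinite ν := by
  obtain ⟨E, hE, -, hU⟩ := R.exists_disjoint_cover
  exact ⟨⟨⟨E, fun _ => trivial, fun n => h _ (hE n), hU⟩⟩⟩

namespace CountingMeasure

variable {R : LocalisingRing X}

@[simp] theorem coe_add (μ ν : CountingMeasure R) : (μ + ν).1 = μ.1 + ν.1 := rfl

@[simp] theorem coe_dirac (x : X) : (dirac R x).1 = Measure.dirac x := rfl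

@[simp] theorem coe_diracSum {n : ℕ} (x : Fin n → X) :
    (diracSum R x).1 = ∑ i, Measure.dirac (x i) := rfl

@[simp] theorem coe_restrict (μ : CountingMeasure R) (s : Set X) :
    (μ.restrict s).1 = μ.1.restrict s := rfl

theorem add_right_comm' (μ ν ψ : CountingMeasure R) : μ + ν + ψ = μ + ψ + ν :=
  Subtype.ext (add_right_comm _ _ _)

theorem add_assoc' (μ ν ψ : CountingMeasure R) : μ + ν + ψ = μ + (ν + ψ) :=
  Subtype.ext (add_assoc _ _ _)

theorem add_comm' (μ ν : CountingMeasure R) : μ + ν = ν + μ :=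
  Subtype.ext (add_comm _ _)

theorem le_add_right' (μ ν : CountingMeasure R) : μ ≤ μ + ν :=
  fun s => by simp

/-- The zero measure as an element of `N`. -/
def zero : CountingMeasure R := ⟨0, fun _ _ => ⟨0, by simp⟩⟩

theorem add_zero' (μ : CountingMeasure R) : μ + zero = μ :=
  Subtype.ext (add_zero _)

theorem diracSum_cons {n : ℕ} (y : X) (x : Fin n → X) :
    diracSum R (Fin.cons y x : Fin (n + 1) → X) = diracSum R x + dirac R y := by
  apply Subtype.ext
  simp [Fin.sum_univ_succ, add_comm]

theorem diracSum_univ {n : ℕ} (x : Fin n → X) : (diracSum R x).1 Set.univ = n := by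
  simp

theorem measurable_iff {α : Type*} [MeasurableSpace α] {f : α → CountingMeasure R} :
    Measurable f ↔ ∀ B, MeasurableSet B → Measurable fun a => (f a).1 B :=
  ⟨fun h _ hB => (Measure.measurable_coe hB).comp (measurable_subtype_coe.comp h),
    fun h => (Measure.measurable_of_measurable_coe _ h).subtype_mk⟩

theorem isLocFinite (μ : CountingMeasure R) : IsLocFinite R μ.1 := fun B hB => by
  obtain ⟨k, hk⟩ := μ.2 B hB
  simp [hk]

/-- The difference is taken setwise; finiteness of `μ` avoids `∞ - ∞`, and integrality on the ring
is inherited. -/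
theorem exists_add_of_le {μ ν : CountingMeasure R} (h : μ ≤ ν) (hf : μ.1 Set.univ < ∞) :
    ∃ ψ, ν = μ + ψ := by
  have : IsFiniteMeasure μ.1 := ⟨hf⟩
  refine ⟨⟨ν.1 - μ.1, fun B hB => ?_⟩, Subtype.ext ?_⟩
  · obtain ⟨k, hk⟩ := μ.2 B hB
    obtain ⟨l, hl⟩ := ν.2 B hB
    exact ⟨l - k, by simp [Measure.sub_apply (R.measurableSet B hB) h, hk, hl]⟩
  · rw [add_comm']
    exact (Measure.sub_add_cancel_of_le h).symm

theorem eq_of_le_of_univ_le {μ ν : CountingMeasure R} (h : μ ≤ ν)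
    (hu : ν.1 Set.univ ≤ μ.1 Set.univ) (hf : ν.1 Set.univ < ∞) : μ = ν := by
  have : IsFiniteMeasure μ.1 := ⟨(h _).trans_lt hf⟩
  exact Subtype.ext (Measure.eq_of_le_of_measure_univ_eq h (le_antisymm (h _) hu))

/-- The mass is a countable sum of integers over ring pieces, and such a sum is infinite as soon as
infinitely many terms are at least `1`. -/
theorem exists_enat_apply (μ : CountingMeasure R) {s : Set X} (hs : MeasurableSet s) :
    μ.1 s = ∞ ∨ ∃ k : ℕ, μ.1 s = k := by
  obtain ⟨E, hE, hd, hU⟩ := R.exists_disjoint_cover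
  choose k hk using fun n => μ.2 _ (R.inter_mem _ (hE n) s hs)
  have h : μ.1 s = ∑' n, ((k n : ℕ∞) : ℝ≥0∞) := by
    rw [← Set.univ_inter s, ← hU, Set.iUnion_inter, measure_iUnion]
    · simp [hk]
    · exact fun i j hij => (hd hij).mono Set.inter_subset_left Set.inter_subset_left
    · exact fun i => (R.measurableSet _ (hE i)).inter hs
  by_cases hfin : (Function.support k).Finite
  · right
    refine ⟨∑ i ∈ hfin.toFinset, k i, ?_⟩
    rw [h, tsum_eq_sum (s := hfin.toFinset)]
    · simp
    · intro i hi
      simpa using hi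
  · left
    rw [h]
    by_contra hne
    have := ENNReal.finite_const_le_of_tsum_ne_top hne one_ne_zero
    apply hfin
    refine this.subset fun i hi => ?_
    have : 1 ≤ k i := Nat.one_le_iff_ne_zero.2 hi
    simpa using this

end CountingMeasure
end

/-! ### Counting measures on a Borel space are determined by their atoms. -/

section

variable {X : Type*} [MeasurableSpace X] [StandardBorelSpace X]

/-- A finite measure without atoms that takes only values in `ℕ` is zero. -/
theorem MeasureTheory.Measure.eq_zero_of_forall_nat (m : Measure X) [IsFiniteMeasure m]
    (hm : ∀ s, MeasurableSet s → ∃ k : ℕ, m s = k) (h0 : ∀ y, m {y} = 0) : m = 0 := by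
  let := upgradeStandardBorel X
  rw [← Measure.measure_univ_eq_zero]
  refine measure_null_of_locally_null _ fun y _ => ?_
  -- By outer regularity each point has an open neighbourhood of mass below `1`, hence of mass `0`
  -- by integrality; in a Polish space a locally null set is null.
  obtain ⟨U, hU, hUo, hlt⟩ := Set.exists_isOpen_lt_of_lt (μ := m) {y} 1 (by simp [h0])
  refine ⟨U, mem_nhdsWithin_of_mem_nhds (hUo.mem_nhds (hU rfl)), ?_⟩
  obtain ⟨k, hk⟩ := hm U hUo.measurableSet
  rw [hk] at hlt ⊢
  have : k < 1 := by exact_mod_cast hlt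
  simp [Nat.lt_one_iff.1 this]

namespace CountingMeasure

variable {R : LocalisingRing X}

theorem exists_nat_singleton (μ : CountingMeasure R) (y : X) : ∃ k : ℕ, μ.1 {y} = k :=
  μ.2 _ (R.singleton_mem y)

theorem singleton_ne_top (μ : CountingMeasure R) (y : X) : μ.1 {y} ≠ ∞ := by
  obtain ⟨k, hk⟩ := μ.exists_nat_singleton y
  simp [hk]

theorem add_one_le_singleton {μ ν : CountingMeasure R} {y : X} (h : μ.1 {y} < ν.1 {y}) :
    μ.1 {y} + 1 ≤ ν.1 {y} := by
  obtain ⟨k, hk⟩ := μ.exists_nat_singleton y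
  obtain ⟨l, hl⟩ := ν.exists_nat_singleton y
  rw [hk, hl] at h ⊢
  have : k < l := by exact_mod_cast h
  exact_mod_cast this

instance instSigmaFinite (μ : CountingMeasure R) : SigmaFinite μ.1 := μ.isLocFinite.sigmaFinite

/-- Pure atomicity: on each ring piece the restriction to `s` is a finite, integer-valued, atomless
measure. -/
theorem apply_eq_zero {μ : CountingMeasure R} {s : Set X} (hs : MeasurableSet s)
    (h : ∀ y ∈ s, μ.1 {y} = 0) : μ.1 s = 0 := by
  obtain ⟨E, hE, -, hU⟩ := R.exists_disjoint_cover
  have key : ∀ n, μ.1 (s ∩ E n) = 0 := by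
    intro n
    have hm := R.measurableSet _ (hE n)
    rw [← Measure.restrict_eq_zero]
    have : IsFiniteMeasure (μ.1.restrict (s ∩ E n)) :=
      ⟨by simpa using (measure_mono Set.inter_subset_right).trans_lt (μ.isLocFinite _ (hE n))⟩
    apply Measure.eq_zero_of_forall_nat
    · intro t ht
      rw [Measure.restrict_apply ht, ← Set.inter_assoc, Set.inter_comm]
      exact μ.2 _ (R.inter_mem _ (hE n) _ (ht.inter hs))
    · intro y
      rw [Measure.restrict_apply (measurableSet_singleton y)]
      by_cases hy : y ∈ s
      · exact measure_mono_null Set.inter_subset_left (h y hy)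
      · rw [Set.singleton_inter_eq_empty.2 (fun h => hy h.1), measure_empty]
  rw [← Set.inter_univ s, ← hU, Set.inter_iUnion]
  exact measure_iUnion_null key

theorem countable_atoms (μ : CountingMeasure R) : {y | 0 < μ.1 {y}}.Countable :=
  Measure.countable_meas_pos_of_disjoint_iUnion (μ := μ.1) (As := fun y : X => ({y} : Set X))
    (fun y => measurableSet_singleton y) (fun _ _ h => by simpa using h)

/-- All mass of `μ` sits on its countably many atoms, so the comparison reduces to a sum over them.
This turns later inequalities and equalities into statements about multiplicities. -/
theorem apply_le_of_singleton {μ ν : CountingMeasure R} {s : Set X} (hs : MeasurableSet s)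
    (h : ∀ y ∈ s, μ.1 {y} ≤ ν.1 {y}) : μ.1 s ≤ ν.1 s := by
  set T := s ∩ {y | 0 < μ.1 {y}} with hT
  have hTc : T.Countable := μ.countable_atoms.mono Set.inter_subset_right
  have h1 : μ.1 s ≤ μ.1 T := by
    rw [← Set.inter_union_sdiff s T]
    refine (measure_union_le _ _).trans ?_
    rw [apply_eq_zero (hs.diff hTc.measurableSet), add_zero]
    · exact measure_mono Set.inter_subset_right
    · intro y hy
      by_contra h0
      exact hy.2 ⟨hy.1, pos_iff_ne_zero.2 h0⟩
  refine h1.trans (le_trans ?_ (measure_mono Set.inter_subset_left : ν.1 T ≤ ν.1 s))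
  have := hTc.to_subtype
  rw [← Set.biUnion_of_singleton T, measure_biUnion hTc (fun i _ j _ hij => by simpa using hij)
    (fun y _ => measurableSet_singleton y), measure_biUnion hTc
    (fun i _ j _ hij => by simpa using hij) (fun y _ => measurableSet_singleton y)]
  exact ENNReal.tsum_le_tsum fun y => h y y.2.1

theorem apply_eq_of_singleton {μ ν : CountingMeasure R} {s : Set X} (hs : MeasurableSet s)
    (h : ∀ y ∈ s, μ.1 {y} = ν.1 {y}) : μ.1 s = ν.1 s :=
  le_antisymm (apply_le_of_singleton hs fun y hy => (h y hy).le)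
    (apply_le_of_singleton hs fun y hy => (h y hy).ge)

theorem le_iff_singleton {μ ν : CountingMeasure R} : μ ≤ ν ↔ ∀ y, μ.1 {y} ≤ ν.1 {y} :=
  ⟨fun h y => h {y}, fun h => Measure.le_iff.2 fun _ hs => apply_le_of_singleton hs fun y _ => h y⟩

theorem dirac_singleton (x y : X) [Decidable (x = y)] :
    Measure.dirac x {y} = if x = y then 1 else 0 := by
  rw [Measure.dirac_apply' _ (measurableSet_singleton y)]
  simp [Set.indicator_apply]

theorem diracSum_singleton_pos {n : ℕ} {x : Fin n → X} {y : X} :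
    0 < (diracSum R x).1 {y} ↔ ∃ i, x i = y := by
  simp [pos_iff_ne_zero]

/-- Multiplicities are integers, so a strict inequality at `y` leaves room for a whole unit mass. -/
theorem add_dirac_le_iff {μ ν : CountingMeasure R} {y : X} (h : μ ≤ ν) :
    μ + dirac R y ≤ ν ↔ μ.1 {y} < ν.1 {y} := by
  classical
  constructor
  · intro h
    have := h {y}
    refine lt_of_lt_of_le ?_ this
    simpa [dirac_singleton] using ENNReal.lt_add_right (μ.singleton_ne_top y) one_ne_zero
  · intro hy
    refine le_iff_singleton.2 fun z => ?_
    by_cases hz : y = z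
    · subst hz
      simpa [dirac_singleton] using add_one_le_singleton hy
    · simpa [dirac_singleton, hz] using h {z}

theorem dirac_le_iff {ν : CountingMeasure R} {y : X} : dirac R y ≤ ν ↔ 0 < ν.1 {y} := by
  have h : zero ≤ ν := fun s => by simp [zero]
  rw [← show zero + dirac R y = dirac R y from Subtype.ext (by simp [zero]), add_dirac_le_iff h]
  simp [zero]

theorem diracSum_le_iff {n : ℕ} {x : Fin n → X} {ν : CountingMeasure R} :
    diracSum R x ≤ ν ↔ ∀ i, (diracSum R x).1 {x i} ≤ ν.1 {x i} := by
  refine ⟨fun h i => h _, fun h => le_iff_singleton.2 fun y => ?_⟩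
  by_cases hy : 0 < (diracSum R x).1 {y}
  · obtain ⟨i, rfl⟩ := diracSum_singleton_pos.1 hy
    exact h i
  · rw [nonpos_iff_eq_zero.1 (not_lt.1 hy)]
    exact zero_le

end CountingMeasure
end

/-! ### Measurability on the space of counting measures. -/

section

variable {X : Type*} [MeasurableSpace X]

namespace CountingMeasure

variable {R : LocalisingRing X}

theorem measurable_apply {B : Set X} (hB : MeasurableSet B) :
    Measurable fun μ : CountingMeasure R => μ.1 B :=
  measurable_iff.1 measurable_id B hB

theorem measurable_add {α : Type*} [MeasurableSpace α] {f g : α → CountingMeasure R}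
    (hf : Measurable f) (hg : Measurable g) : Measurable fun a => f a + g a :=
  measurable_iff.2 fun B hB => by
    exact (measurable_iff.1 hf B hB).add (measurable_iff.1 hg B hB)

theorem measurable_dirac : Measurable (dirac R) :=
  Measurable.subtype_mk Measure.measurable_dirac

theorem measurable_diracSum {n : ℕ} : Measurable (diracSum R : (Fin n → X) → CountingMeasure R) :=
  measurable_iff.2 fun B hB => by
    simp only [coe_diracSum, Measure.coe_finsetSum, Finset.sum_apply]
    exact Finset.measurable_sum _ fun i _ =>
      (Measure.measurable_coe hB).comp (Measure.measurable_dirac.comp (measurable_pi_apply i))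

theorem measurable_restrict {s : Set X} (hs : MeasurableSet s) :
    Measurable fun μ : CountingMeasure R => μ.restrict s :=
  measurable_iff.2 fun B hB => by
    simp only [coe_restrict, Measure.restrict_apply hB]
    exact measurable_apply (hB.inter hs)

/-- The identity on `N`, seen as a kernel from `N` to `X`. -/
def toKernel (R : LocalisingRing X) : Kernel (CountingMeasure R) X :=
  ⟨Subtype.val, measurable_subtype_coe⟩

@[simp] theorem toKernel_apply (μ : CountingMeasure R) : toKernel R μ = μ.1 := rfl

/-- The mass of a ring piece `E n` is finite for each `μ` but not bounded in `μ`; splitting also by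
the value `μ (E n) = k` gives finite kernels. Measurability of integrals against a varying counting
measure rests on this. -/
instance instIsSFiniteKernel : IsSFiniteKernel (toKernel R) := by
  classical
  obtain ⟨E, hE, hd, hU⟩ := R.exists_disjoint_cover
  have hEm := fun n => R.measurableSet _ (hE n)
  have hS : ∀ p : ℕ × ℕ, MeasurableSet {μ : CountingMeasure R | μ.1 (E p.1) = p.2} := fun p =>
    measurable_apply (hEm p.1) (measurableSet_singleton _)
  have key : toKernel R = Kernel.sum fun p : ℕ × ℕ =>
      Kernel.piecewise (hS p) ((toKernel R).restrict (hEm p.1)) 0 := by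
    ext μ s hs
    rw [Kernel.sum_apply, Measure.sum_apply _ hs, ENNReal.tsum_prod']
    have h1 : ∀ n, ∑' k, (Kernel.piecewise (hS (n, k)) ((toKernel R).restrict (hEm n)) 0) μ s
        = μ.1 (s ∩ E n) := by
      intro n
      obtain ⟨l, hl⟩ := μ.2 _ (hE n)
      rw [tsum_eq_single l]
      · simp [Kernel.piecewise_apply, hl, Kernel.restrict_apply, Measure.restrict_apply hs]
      · intro k hk
        simp [Kernel.piecewise_apply, hl, hk.symm]
    rw [tsum_congr h1, ← measure_iUnion, ← Set.inter_iUnion, hU, Set.inter_univ, toKernel_apply]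
    · exact fun i j hij => (hd hij).mono Set.inter_subset_right Set.inter_subset_right
    · exact fun n => hs.inter (hEm n)
  rw [key]
  refine Kernel.isSFiniteKernel_sum (hκs := fun p => ?_)
  have : IsFiniteKernel (Kernel.piecewise (hS p) ((toKernel R).restrict (hEm p.1)) 0) := by
    refine ⟨⟨p.2, by simp, fun μ => ?_⟩⟩
    rw [Kernel.piecewise_apply]
    split_ifs with h
    · simpa [Kernel.restrict_apply] using (show μ.1 (E p.1) = p.2 from h).le
    · simp
  infer_instance

theorem measurable_lintegral {α : Type*} [MeasurableSpace α] {g : α → CountingMeasure R}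
    (hg : Measurable g) {f : α → X → ℝ≥0∞} (hf : Measurable (Function.uncurry f)) :
    Measurable fun a => ∫⁻ y, f a y ∂(g a).1 :=
  hf.lintegral_kernel_prod_right (κ := (toKernel R).comap g hg)

theorem measurable_restrict_of_prod {α : Type*} [MeasurableSpace α] {g : α → CountingMeasure R}
    (hg : Measurable g) {s : α → Set X} (hs : MeasurableSet {p : α × X | p.2 ∈ s p.1}) :
    Measurable fun a => (g a).restrict (s a) :=
  measurable_iff.2 fun B hB => by
    have h : ∀ a, ((g a).restrict (s a)).1 B =
        ∫⁻ y, ({p : α × X | p.2 ∈ s p.1} ∩ Prod.snd ⁻¹' B).indicator 1 (a, y) ∂(g a).1 := by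
      intro a
      have hsa : MeasurableSet (s a) := measurable_prodMk_left (x := a) hs
      rw [coe_restrict, Measure.restrict_apply hB, ← lintegral_indicator_one (hB.inter hsa)]
      refine lintegral_congr fun y => ?_
      classical
      simp [Set.indicator_apply, and_comm]
    rw [funext h]
    refine measurable_lintegral hg (f := fun a y =>
      ({p : α × X | p.2 ∈ s p.1} ∩ Prod.snd ⁻¹' B).indicator 1 (a, y)) ?_
    exact measurable_one.indicator (hs.inter (measurable_snd hB))

variable [StandardBorelSpace X]

theorem measurable_apply_singleton {α : Type*} [MeasurableSpace α] {g : α → CountingMeasure R}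
    (hg : Measurable g) {y : α → X} (hy : Measurable y) :
    Measurable fun a => (g a).1 {y a} := by
  have h : ∀ a, (g a).1 {y a} =
      ∫⁻ z, {p : α × X | p.2 = y p.1}.indicator 1 (a, z) ∂(g a).1 := by
    intro a
    rw [← lintegral_indicator_one (measurableSet_singleton _)]
    refine lintegral_congr fun z => ?_
    classical
    simp [Set.indicator_apply]
  rw [funext h]
  refine measurable_lintegral hg (f := fun a z =>
    {p : α × X | p.2 = y p.1}.indicator 1 (a, z)) ?_
  exact measurable_one.indicator (measurableSet_eq_fun measurable_snd (hy.comp measurable_fst))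

/-- Two counting measures coincide exactly when their sum does not charge the set where their
multiplicities differ. Measurability of the hull and of `fixedTuples` needs this. -/
instance instMeasurableEq : MeasurableEq (CountingMeasure R) := by
  refine ⟨?_⟩
  have h : Set.diagonal (CountingMeasure R) = {p | ∫⁻ y,
      {q : (CountingMeasure R × CountingMeasure R) × X |
        q.1.1.1 {q.2} = q.1.2.1 {q.2}}ᶜ.indicator 1 (p, y) ∂(p.1 + p.2).1 = 0} := by
    ext ⟨μ, ν⟩
    simp only [Set.mem_diagonal_iff, Set.mem_ofPred_eq]
    constructor
    · rintro rfl
      simp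
    · intro h0
      have hm := measurable_apply_singleton (R := R) (measurable_const (a := μ)) measurable_id
      have hn := measurable_apply_singleton (R := R) (measurable_const (a := ν)) measurable_id
      have hs : MeasurableSet {y | μ.1 {y} = ν.1 {y}} := measurableSet_eq_fun hm hn
      have h1 : (μ + ν).1 {y | μ.1 {y} = ν.1 {y}}ᶜ = 0 := by
        rw [← lintegral_indicator_one hs.compl, ← h0]
        rfl
      refine Subtype.ext (Measure.ext fun B hB => apply_eq_of_singleton hB fun y _ => ?_)
      by_contra hne
      have h2 : (μ + ν).1 {y} = 0 :=
        measure_mono_null (Set.singleton_subset_iff.2 hne) h1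
      simp only [coe_add, Measure.add_apply, add_eq_zero] at h2
      exact hne (h2.1.trans h2.2.symm)
  rw [h]
  refine measurable_lintegral (R := R) (f := fun p y =>
      {q : (CountingMeasure R × CountingMeasure R) × X |
        q.1.1.1 {q.2} = q.1.2.1 {q.2}}ᶜ.indicator 1 (p, y))
    (measurable_add measurable_fst measurable_snd) ?_ (measurableSet_singleton 0)
  refine measurable_one.indicator (measurableSet_eq_fun ?_ ?_).compl
  · exact measurable_apply_singleton (by fun_prop) measurable_snd
  · exact measurable_apply_singleton (by fun_prop) measurable_snd

theorem measurableSet_diracSum_le {α : Type*} [MeasurableSpace α] {n : ℕ} {x : α → Fin n → X}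
    (hx : Measurable x) {g : α → CountingMeasure R} (hg : Measurable g) :
    MeasurableSet {a | diracSum R (x a) ≤ g a} := by
  simp only [diracSum_le_iff, Set.ofPred_forall]
  refine MeasurableSet.iInter fun i => measurableSet_le ?_ ?_
  · exact measurable_apply_singleton (measurable_diracSum.comp hx) (by fun_prop)
  · exact measurable_apply_singleton hg (by fun_prop)

theorem measurableSet_mem_hull {D : CountingMeasure R → CountingMeasure R} (hD : Measurable D) :
    MeasurableSet {p : CountingMeasure R × X | p.2 ∈ hull D p.1} :=
  measurableSet_eq_fun (hD.comp (measurable_add measurable_fst (measurable_dirac.comp measurable_snd)))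
    (hD.comp measurable_fst)

theorem measurableSet_hull {D : CountingMeasure R → CountingMeasure R} (hD : Measurable D)
    (μ : CountingMeasure R) : MeasurableSet (hull D μ) :=
  measurable_prodMk_left (x := μ) (measurableSet_mem_hull hD)

theorem measurableSet_fixedTuples {D : CountingMeasure R → CountingMeasure R} (hD : Measurable D)
    (n : ℕ) : MeasurableSet (fixedTuples D n) :=
  measurableSet_eq_fun (hD.comp measurable_diracSum) measurable_diracSum

end CountingMeasure
end

/-! ### Deterministic properties of generators. -/

section

variable {X : Type*} [MeasurableSpace X] {R : LocalisingRing X}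

namespace IsGenerator

open CountingMeasure

variable {D : CountingMeasure R → CountingMeasure R}

theorem apply_apply (hD : IsGenerator D) (μ : CountingMeasure R) : D (D μ) = D μ := by
  have := hD.idempotency μ zero (by rw [add_zero']; exact hD.thinning μ)
  rwa [add_zero'] at this

/-- (H4) applies because `D μ ≤ μ` have the same image. The hull is therefore a function of the
selected points alone. -/
theorem hull_apply (hD : IsGenerator D) (μ : CountingMeasure R) : hull D (D μ) = hull D μ := by
  ext y
  simp only [hull, Set.mem_ofPred_eq, hD.apply_apply]
  rw [hD.consistency μ (D μ) (hD.thinning μ) (hD.apply_apply μ).symm]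

theorem add_of_mem_hull (hD : IsGenerator D) {μ : CountingMeasure R} {y : X} (hy : y ∈ hull D μ)
    (ψ : CountingMeasure R) : D (μ + dirac R y + ψ) = D (μ + ψ) :=
  hD.consistency _ _ (le_add_right' _ _) hy ψ

variable [StandardBorelSpace X]

theorem add_dirac_ne (μ : CountingMeasure R) (y : X) : μ + dirac R y ≠ μ := by
  intro h
  have h1 := congrArg (fun ν : CountingMeasure R => ν.1 {y}) h
  simp only [coe_add, coe_dirac, Measure.add_apply, Measure.dirac_apply_of_mem (Set.mem_singleton y)]
    at h1
  exact absurd h1 (ENNReal.lt_add_right (μ.singleton_ne_top y) one_ne_zero).ne'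

/-- A selected point is selected with full multiplicity: were a copy of `y` left over, adding it to
`D μ` would change nothing by (H3), yet would add `δ_y` by (H2). -/
theorem singleton_eq_of_pos (hD : IsGenerator D) (μ : CountingMeasure R) {y : X}
    (hy : 0 < (D μ).1 {y}) : (D μ).1 {y} = μ.1 {y} := by
  by_contra hne
  have hle : D μ + dirac R y ≤ μ :=
    (add_dirac_le_iff (hD.thinning μ)).2 (lt_of_le_of_ne (hD.thinning μ {y}) hne)
  have h1 := hD.idempotency μ (dirac R y) hle
  rw [hD.additivity (D μ) y (by rwa [hD.apply_apply]), hD.apply_apply] at h1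
  exact add_dirac_ne _ _ h1

theorem notMem_hull (hD : IsGenerator D) {μ : CountingMeasure R} {y : X}
    (hy : 0 < (D μ).1 {y}) : y ∉ hull D μ := fun h => by
  rw [hull, Set.mem_ofPred_eq, hD.additivity μ y hy] at h
  exact add_dirac_ne _ _ h

/-- One copy of `y` in `ν` can be removed without changing the selection, since `y` lies in the
hull. If `y` were selected, its full multiplicity would exceed what remains after the removal. -/
theorem apply_singleton_eq_zero (hD : IsGenerator D) {μ ν : CountingMeasure R} {y : X}
    (hν : 0 < ν.1 {y}) (hy : y ∈ hull D μ) : (D (ν + μ)).1 {y} = 0 := by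
  by_contra h0
  have h1 := hD.singleton_eq_of_pos (ν + μ) (pos_iff_ne_zero.2 h0)
  obtain ⟨ψ, rfl⟩ := exists_add_of_le (dirac_le_iff.2 hν) (by simp)
  have h2 : D (dirac R y + ψ + μ) = D (μ + ψ) := by
    rw [← hD.add_of_mem_hull hy ψ, add_comm' _ μ, add_assoc']
  have h3 : (D (μ + ψ)).1 {y} ≤ (μ + ψ).1 {y} := hD.thinning _ _
  rw [← h2, h1] at h3
  have h4 : (dirac R y + ψ + μ).1 {y} = (μ + ψ).1 {y} + 1 := by
    simp only [coe_add, coe_dirac, Measure.add_apply,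
      Measure.dirac_apply_of_mem (Set.mem_singleton y)]
    ring
  rw [h4] at h3
  exact absurd h3 (not_le.2 (ENNReal.lt_add_right ((μ + ψ).singleton_ne_top y) one_ne_zero))

/-- For finite `μ` and arbitrary `ν`, the generator selects `μ` from `ν + μ` if and only if it
fixes `μ` and `ν` does not charge the complement of the hull of `μ`. -/
theorem apply_add_eq_iff (hD : IsGenerator D) {μ ν : CountingMeasure R} (hf : μ.1 Set.univ < ∞) :
    D (ν + μ) = μ ↔ D μ = μ ∧ ν.1 (hull D μ)ᶜ = 0 := by
  constructor
  · intro h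
    have hμ : D μ = μ := by rw [← h, hD.apply_apply]
    refine ⟨hμ, apply_eq_zero (measurableSet_hull hD.measurable μ).compl fun y hy => ?_⟩
    by_contra h0
    apply hy
    -- A point `y` of `ν` is an unselected surplus over `D (ν + μ) = μ`, so (H3) puts it in the
    -- hull.
    have hle : D (ν + μ) + dirac R y ≤ ν + μ := by
      rw [add_dirac_le_iff (hD.thinning _), h, coe_add, Measure.add_apply, add_comm]
      exact ENNReal.lt_add_right (μ.singleton_ne_top y) h0
    have := hD.idempotency _ _ hle
    rw [h] at this
    simp only [hull, Set.mem_ofPred_eq]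
    rw [this, hμ]
  · rintro ⟨hμ, h0⟩
    have hle : D (ν + μ) ≤ μ := by
      refine le_iff_singleton.2 fun y => ?_
      by_cases hy : ν.1 {y} = 0
      · refine (hD.thinning (ν + μ) {y}).trans ?_
        simp [hy]
      · have hmem : y ∈ hull D μ := by
          by_contra hn
          exact hy (measure_mono_null (Set.singleton_subset_iff.2 hn) h0)
        simp [hD.apply_singleton_eq_zero (pos_iff_ne_zero.2 hy) hmem]
    -- No point of `ν` survives, so `μ` lies between `D (ν + μ)` and `ν + μ`; (H3) with `ψ` the
    -- missing part of `μ` then gives `D μ = D (ν + μ)`.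
    obtain ⟨ψ, hψ⟩ := exists_add_of_le hle ((hle _).trans_lt hf)
    have h1 := hD.idempotency (ν + μ) ψ 
      (by rw [← hψ, CountingMeasure.add_comm' ν]; exact le_add_right' _ _)
    rw [← hψ, hμ] at h1
    exact h1.symm

/-- The hull depends only on the selection `δ_x`, and by (H2) selected points never lie in it, so
`δ_x` contributes nothing. -/
theorem restrict_hull_add (hD : IsGenerator D) {n : ℕ} {x : Fin n → X} {ν : CountingMeasure R}
    (h : D (ν + diracSum R x) = diracSum R x) :
    (ν + diracSum R x).restrict (hull D (ν + diracSum R x)) =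
      ν.restrict (hull D (diracSum R x)) := by
  have hμ := ((hD.apply_add_eq_iff (by simp)).1 h).1
  rw [← hD.hull_apply (ν + _), h]
  apply Subtype.ext
  rw [coe_restrict, coe_add, Measure.restrict_add, coe_restrict]
  have : (diracSum R x).1.restrict (hull D (diracSum R x)) = 0 := by
    rw [Measure.restrict_eq_zero]
    refine apply_eq_zero (measurableSet_hull hD.measurable _) fun y hy => ?_
    by_contra h0
    exact hD.notMem_hull (by rw [hμ]; exact pos_iff_ne_zero.2 h0) hy
  rw [this, add_zero]

/-- The number of points of `ν` that complete `μ` within the selection from `ν + μ`. -/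
theorem apply_setOf_add_dirac_le (hD : IsGenerator D) {μ ν : CountingMeasure R}
    (h : μ ≤ D (ν + μ)) :
    ν.1 {y | μ + dirac R y ≤ D (ν + μ)} + μ.1 Set.univ = (D (ν + μ)).1 Set.univ := by
  set κ := D (ν + μ) with hκ
  have hS : {y | μ + dirac R y ≤ κ} = {y | μ.1 {y} < κ.1 {y}} := by
    ext y
    exact add_dirac_le_iff h
  rw [hS]
  set S := {y | μ.1 {y} < κ.1 {y}} with hSdef
  have hSm : MeasurableSet S := by
    refine (κ.countable_atoms.mono fun y hy => ?_).measurableSet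
    exact (show μ.1 {y} < κ.1 {y} from hy).pos
  -- On `S` the selection takes full multiplicity; off `S` it already equals `μ`.
  have h1 : (ν + μ).1 S = κ.1 S := apply_eq_of_singleton hSm fun y hy =>
    (hD.singleton_eq_of_pos _ (show μ.1 {y} < κ.1 {y} from hy).pos).symm
  have h2 : μ.1 Sᶜ = κ.1 Sᶜ := apply_eq_of_singleton hSm.compl fun y hy =>
    le_antisymm (h _) (not_lt.1 hy)
  rw [← measure_add_measure_compl hSm, ← measure_add_measure_compl hSm, ← h1, ← h2, ← add_assoc]
  rfl

end IsGenerator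
end

/-! ### Laws of Poisson processes: uniqueness, restriction, independence. -/

section

namespace MeasureTheory.Measure

theorem ext_of_pi_univ {ι : Type*} [Finite ι] {α : ι → Type*} [∀ i, MeasurableSpace (α i)]
    {μ ν : Measure (∀ i, α i)} [IsFiniteMeasure μ]
    (h : ∀ T : ∀ i, Set (α i), (∀ i, MeasurableSet (T i)) →
      μ (Set.univ.pi T) = ν (Set.univ.pi T)) : μ = ν := by
  refine ext_of_generate_finite _ generateFrom_pi.symm isPiSystem_pi ?_ ?_
  · rintro _ ⟨T, hT, rfl⟩
    exact h T fun i => hT i trivial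
  · simpa using h (fun _ => Set.univ) fun _ => MeasurableSet.univ

end MeasureTheory.Measure

variable {X : Type*} [MeasurableSpace X] {R : LocalisingRing X}

namespace CountingMeasure

theorem measurableSet_forall_mem {ι : Type*} [Finite ι] {B : ι → Set X}
    (hB : ∀ i, MeasurableSet (B i)) {T : ι → Set ℝ≥0∞} (hT : ∀ i, MeasurableSet (T i)) :
    MeasurableSet {μ : CountingMeasure R | ∀ i, μ.1 (B i) ∈ T i} := by
  rw [Set.ofPred_forall]
  exact MeasurableSet.iInter fun i => measurable_apply (hB i) (hT i)

/-- The sets of counting measures specified by finitely many evaluations. -/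
def cylinders (R : LocalisingRing X) : Set (Set (CountingMeasure R)) :=
  {S | ∃ (m : ℕ) (B : Fin m → Set X) (T : Fin m → Set ℝ≥0∞), (∀ i, MeasurableSet (B i)) ∧
    (∀ i, MeasurableSet (T i)) ∧ S = {μ | ∀ i, μ.1 (B i) ∈ T i}}

theorem isPiSystem_cylinders : IsPiSystem (cylinders R) := by
  rintro _ ⟨m, B, T, hB, hT, rfl⟩ _ ⟨m', B', T', hB', hT', rfl⟩ -
  refine ⟨m + m', Fin.append B B', Fin.append T T', ?_, ?_, ?_⟩
  · intro i
    refine Fin.addCases (fun i => ?_) (fun i => ?_) i <;> simp [hB, hB']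
  · intro i
    refine Fin.addCases (fun i => ?_) (fun i => ?_) i <;> simp [hT, hT']
  · ext μ
    simp [Fin.forall_fin_add]

theorem generateFrom_cylinders :
    (inferInstance : MeasurableSpace (CountingMeasure R)) =
      MeasurableSpace.generateFrom (cylinders R) := by
  refine le_antisymm ?_ (MeasurableSpace.generateFrom_le ?_)
  · have h : Measurable[MeasurableSpace.generateFrom (cylinders R)]
        (fun μ : CountingMeasure R => μ.1) := by
      refine @Measure.measurable_of_measurable_coe _ _ _
        (MeasurableSpace.generateFrom (cylinders R)) _ fun B hB T hT => ?_
      refine MeasurableSpace.measurableSet_generateFrom ⟨1, fun _ => B, fun _ => T,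
        fun _ => hB, fun _ => hT, ?_⟩
      ext μ
      simp
    exact h.comap_le
  · rintro _ ⟨m, B, T, hB, hT, rfl⟩
    exact measurableSet_forall_mem hB hT

/-- Finite measures on `N` that agree on all events specified by the values on a finite partition
that is compatible with a given set `C` are equal. -/
theorem ext_of_partition {C : Set X} (hC : MeasurableSet C) {Q Q' : Measure (CountingMeasure R)}
    [IsFiniteMeasure Q]
    (h : ∀ (ι : Type) [Fintype ι] [DecidableEq ι] (B : ι → Set X), (∀ i, MeasurableSet (B i)) →
      Pairwise (fun i j => Disjoint (B i) (B j)) → (⋃ i, B i) = Set.univ →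
      (∀ i, B i ⊆ C ∨ Disjoint (B i) C) → ∀ T : ι → Set ℝ≥0∞, (∀ i, MeasurableSet (T i)) →
      Q {μ | ∀ i, μ.1 (B i) ∈ T i} = Q' {μ | ∀ i, μ.1 (B i) ∈ T i}) : Q = Q' := by
  classical
  have key : ∀ S ∈ cylinders R, Q S = Q' S := by
    rintro _ ⟨m, B, T, hB, hT, rfl⟩
    -- The fibres of `g` are the cells generated by `C` and the `B i`; each `μ (B i)` is a sum of
    -- cell masses.
    let g : X → Bool × (Fin m → Bool) := fun y => (decide (y ∈ C), fun i => decide (y ∈ B i))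
    have hg : Measurable g := by
      refine Measurable.prodMk ?_ (measurable_pi_iff.2 fun i => ?_)
      · exact measurable_to_bool (by convert hC; ext; simp)
      · exact measurable_to_bool (by convert hB i; ext; simp)
    have hA : ∀ p, MeasurableSet (g ⁻¹' {p}) := fun p => hg (measurableSet_singleton p)
    let V : CountingMeasure R → Bool × (Fin m → Bool) → ℝ≥0∞ := fun μ p => μ.1 (g ⁻¹' {p})
    have hV : Measurable V := measurable_pi_iff.2 fun p => measurable_apply (hA p)
    have hQ : Q.map V = Q'.map V := by
      refine Measure.ext_of_pi_univ fun U hU => ?_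
      rw [Measure.map_apply hV (MeasurableSet.univ_pi hU),
        Measure.map_apply hV (MeasurableSet.univ_pi hU)]
      have hpre : V ⁻¹' Set.univ.pi U = {μ | ∀ p, μ.1 (g ⁻¹' {p}) ∈ U p} := by
        ext μ
        simp [V]
      rw [hpre]
      refine h _ _ hA ?_ ?_ ?_ _ hU
      · intro p q hpq
        exact Disjoint.preimage g (by simpa using hpq)
      · rw [← Set.preimage_iUnion, Set.iUnion_of_singleton, Set.preimage_univ]
      · rintro ⟨b, p⟩
        cases b
        · right
          rw [Set.disjoint_left]
          intro y hy hyC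
          have : g y = (false, p) := hy
          simp [g, hyC] at this
        · left
          intro y hy
          have : g y = (true, p) := hy
          simpa [g] using congrArg Prod.fst this
    have hW : MeasurableSet {v : Bool × (Fin m → Bool) → ℝ≥0∞ |
        ∀ i, ∑ p with p.2 i = true, v p ∈ T i} := by
      rw [Set.ofPred_forall]
      exact MeasurableSet.iInter fun i =>
        (Finset.measurable_sum _ fun p _ => measurable_pi_apply p) (hT i)
    have hpre : {μ : CountingMeasure R | ∀ i, μ.1 (B i) ∈ T i} =
        V ⁻¹' {v | ∀ i, ∑ p with p.2 i = true, v p ∈ T i} := by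
      ext μ
      refine forall_congr' fun i => ?_
      have : ∑ p with p.2 i = true, V μ p = μ.1 (B i) := by
        rw [sum_measure_preimage_singleton _ fun p _ => hA p]
        congr 1
        ext y
        simp [g]
      rw [this]
    rw [hpre, ← Measure.map_apply hV hW, ← Measure.map_apply hV hW, hQ]
  refine ext_of_generate_finite _ generateFrom_cylinders isPiSystem_cylinders key ?_
  have := key {μ | ∀ i : Fin 0, μ.1 (Fin.elim0 i) ∈ Set.univ}
    ⟨0, fun i => i.elim0, fun _ => Set.univ, fun i => i.elim0, fun i => i.elim0, by simp⟩
  simpa using this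

end CountingMeasure

namespace IsPoissonProcess

open CountingMeasure

variable {Ω : Type*} [MeasurableSpace Ω] {P : Measure Ω} {ν : Measure X}
  {η : Ω → CountingMeasure R}

theorem measurable_apply (hη : IsPoissonProcess P ν η) {B : Set X} (hB : MeasurableSet B) :
    Measurable fun ω => (η ω).1 B :=
  measurable_iff.1 hη.measurable B hB

theorem isProbabilityMeasure (hη : IsPoissonProcess P ν η) : IsProbabilityMeasure P :=
  (hη.indep 0 (fun i => i.elim0) (fun i => i.elim0) fun i => i.elim0).isProbabilityMeasure

theorem iIndepFun_apply (hη : IsPoissonProcess P ν η) {ι : Type*} [Finite ι] {B : ι → Set X}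
    (hB : ∀ i, MeasurableSet (B i)) (hd : Pairwise fun i j => Disjoint (B i) (B j)) :
    iIndepFun (fun i ω => (η ω).1 (B i)) P := by
  have := Fintype.ofFinite ι
  have e := Fintype.equivFin ι
  have h := hη.indep _ (fun j => B (e.symm j)) (fun j => hB _)
    (fun i j hij => hd (e.symm.injective.ne hij))
  simpa using h.precomp e.injective

theorem prob_forall_mem (hη : IsPoissonProcess P ν η) {ι : Type*} [Fintype ι] {B : ι → Set X}
    (hB : ∀ i, MeasurableSet (B i)) (hd : Pairwise fun i j => Disjoint (B i) (B j))
    {T : ι → Set ℝ≥0∞} (hT : ∀ i, MeasurableSet (T i)) :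
    P {ω | ∀ i, (η ω).1 (B i) ∈ T i} = ∏ i, P {ω | (η ω).1 (B i) ∈ T i} := by
  have h := (hη.iIndepFun_apply hB hd).measure_inter_preimage_eq_mul Finset.univ
    (sets := T) (fun i _ => hT i)
  have hset : {ω | ∀ i, (η ω).1 (B i) ∈ T i} =
      ⋂ i ∈ Finset.univ, (fun ω => (η ω).1 (B i)) ⁻¹' T i := by
    ext ω
    simp
  rw [hset]
  exact h

/-- Only the probabilities of finite values are prescribed. A set containing `∞` is handled through
its complement in `prob_mem_eq`. -/
theorem prob_mem_of_top_notMem (hη : IsPoissonProcess P ν η) {B : Set X} (hB : MeasurableSet B)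
    {T : Set ℝ≥0∞} (hT : ∞ ∉ T) :
    P {ω | (η ω).1 B ∈ T} =
      ∑' k : {k : ℕ // (k : ℝ≥0∞) ∈ T}, expNeg (ν B) * ν B ^ k.1 / (k.1.factorial : ℝ≥0∞) := by
  have h : {ω | (η ω).1 B ∈ T} =
      ⋃ k : {k : ℕ // (k : ℝ≥0∞) ∈ T}, {ω | (η ω).1 B = k.1} := by
    ext ω
    simp only [Set.mem_ofPred_eq, Set.mem_iUnion]
    constructor
    · intro hω
      rcases (η ω).exists_enat_apply hB with h | ⟨k, hk⟩
      · exact absurd (h ▸ hω) hT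
      · exact ⟨⟨k, hk ▸ hω⟩, hk⟩
    · rintro ⟨k, hk⟩
      rw [hk]
      exact k.2
  rw [h, measure_iUnion]
  · exact tsum_congr fun k => hη.prob_eq B hB k
  · intro k l hkl
    rw [Function.onFun, Set.disjoint_left]
    intro ω hk hl
    apply hkl
    have : (k.1 : ℝ≥0∞) = l.1 := (show _ = _ from hk).symm.trans hl
    exact Subtype.ext (by exact_mod_cast this)
  · exact fun k => hη.measurable_apply hB (measurableSet_singleton _)

theorem prob_mem_eq_one_sub (hη : IsPoissonProcess P ν η) {B : Set X} (hB : MeasurableSet B)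
    {T : Set ℝ≥0∞} (hT : MeasurableSet T) :
    P {ω | (η ω).1 B ∈ T} = 1 - P {ω | (η ω).1 B ∈ Tᶜ} := by
  have := hη.isProbabilityMeasure
  refine Eq.trans ?_ (prob_compl_eq_one_sub (hη.measurable_apply hB hT.compl))
  congr 1
  ext ω
  simp

variable {Ω' : Type*} [MeasurableSpace Ω'] {P' : Measure Ω'} {η' : Ω' → CountingMeasure R}

theorem prob_mem_eq (hη : IsPoissonProcess P ν η) (hη' : IsPoissonProcess P' ν η') {B : Set X}
    (hB : MeasurableSet B) {T : Set ℝ≥0∞} (hT : MeasurableSet T) :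
    P {ω | (η ω).1 B ∈ T} = P' {ω | (η' ω).1 B ∈ T} := by
  by_cases h : ∞ ∈ T
  · rw [hη.prob_mem_eq_one_sub hB hT, hη'.prob_mem_eq_one_sub hB hT,
      hη.prob_mem_of_top_notMem hB (by simpa using h),
      hη'.prob_mem_of_top_notMem hB (by simpa using h)]
  · rw [hη.prob_mem_of_top_notMem hB h, hη'.prob_mem_of_top_notMem hB h]

/-- The law of a Poisson process is determined by its intensity measure. -/
theorem map_eq (hη : IsPoissonProcess P ν η) (hη' : IsPoissonProcess P' ν η') :
    P.map η = P'.map η' := by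
  have := hη.isProbabilityMeasure
  refine ext_of_partition MeasurableSet.univ fun ι _ _ B hB hd _ _ T hT => ?_
  rw [Measure.map_apply hη.measurable (measurableSet_forall_mem hB hT),
    Measure.map_apply hη'.measurable (measurableSet_forall_mem hB hT)]
  refine (hη.prob_forall_mem hB hd hT).trans (Eq.trans ?_ (hη'.prob_forall_mem hB hd hT).symm)
  exact Finset.prod_congr rfl fun i _ => hη.prob_mem_eq hη' (hB i) (hT i)

theorem map_id (hη : IsPoissonProcess P ν η) : IsPoissonProcess (P.map η) ν id where
  measurable := measurable_id
  prob_eq B hB k := by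
    refine (Measure.map_apply hη.measurable
      (CountingMeasure.measurable_apply hB (measurableSet_singleton _))).trans ?_
    exact hη.prob_eq B hB k
  indep m B hB hd := by
    rw [iIndepFun_iff_measure_inter_preimage_eq_mul]
    intro S T hT
    have hm : ∀ i ∈ S, MeasurableSet ((fun μ : CountingMeasure R => (id μ).1 (B i)) ⁻¹' T i) :=
      fun i hi => CountingMeasure.measurable_apply (hB i) (hT i hi)
    rw [Measure.map_apply hη.measurable (S.measurableSet_biInter hm)]
    rw [Finset.prod_congr rfl fun i hi => Measure.map_apply hη.measurable (hm i hi)]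
    rw [Set.preimage_iInter₂]
    exact (hη.iIndepFun_apply hB hd).measure_inter_preimage_eq_mul S hT

theorem restrict (hη : IsPoissonProcess P ν η) {s : Set X} (hs : MeasurableSet s) :
    IsPoissonProcess P (ν.restrict s) fun ω => (η ω).restrict s where
  measurable := (measurable_restrict hs).comp hη.measurable
  prob_eq B hB k := by
    simp only [coe_restrict, Measure.restrict_apply hB]
    exact hη.prob_eq _ (hB.inter hs) k
  indep m B hB hd := by
    simp only [coe_restrict, Measure.restrict_apply (hB _)]
    exact hη.iIndepFun_apply (fun i => (hB i).inter hs)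
      fun i j hij => (hd hij).mono Set.inter_subset_left Set.inter_subset_left

/-- The law of `η` witnesses existence, and uniqueness makes the choice in `poissonLaw` immaterial.
-/
theorem poissonLaw_eq (hη : IsPoissonProcess P ν η) : poissonLaw R ν = P.map η := by
  have := hη.isProbabilityMeasure
  have h : ∃ Q : Measure (CountingMeasure R), IsProbabilityMeasure Q ∧ IsPoissonProcess Q ν id :=
    ⟨P.map η, Measure.isProbabilityMeasure_map hη.measurable.aemeasurable, hη.map_id⟩
  rw [poissonLaw, dif_pos h, hη.map_eq h.choose_spec.2, Measure.map_id]

theorem prob_eq_zero (hη : IsPoissonProcess P ν η) {B : Set X} (hB : MeasurableSet B) :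
    P {ω | (η ω).1 B = 0} = expNeg (ν B) := by
  simpa using hη.prob_eq B hB 0

/-- The restrictions of a Poisson process to a set and to its complement are independent; here the
event in the complement is that there are no points. -/
theorem prob_compl_eq_zero_inter (hη : IsPoissonProcess P ν η) {s : Set X} (hs : MeasurableSet s)
    {A : Set (CountingMeasure R)} (hA : MeasurableSet A) :
    P {ω | (η ω).1 sᶜ = 0 ∧ (η ω).restrict s ∈ A} =
      expNeg (ν sᶜ) * P {ω | (η ω).restrict s ∈ A} := by
  have := hη.isProbabilityMeasure
  have hr : Measurable fun ω => (η ω).restrict s := (measurable_restrict hs).comp hη.measurable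
  have h0 : MeasurableSet {ω | (η ω).1 sᶜ = 0} :=
    hη.measurable_apply hs.compl (measurableSet_singleton 0)
  have key : (P.restrict {ω | (η ω).1 sᶜ = 0}).map (fun ω => (η ω).restrict s) =
      expNeg (ν sᶜ) • P.map (fun ω => (η ω).restrict s) := by
    refine ext_of_partition MeasurableSet.univ fun ι _ _ B hB hd _ _ T hT => ?_
    have hm := measurableSet_forall_mem (R := R) hB hT
    rw [Measure.map_apply hr hm, Measure.restrict_apply (hr hm), Measure.smul_apply,
      Measure.map_apply hr hm, ← hη.prob_eq_zero hs.compl, smul_eq_mul]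
    have h1 := hη.prob_forall_mem (fun i => (hB i).inter hs)
      (fun i j hij => (hd hij).mono Set.inter_subset_left Set.inter_subset_left) hT
    -- The extra index `none` carries the cell `sᶜ`, constrained to be empty, and splits off as one
    -- factor.
    have h2 := hη.prob_forall_mem (ι := Option ι) (B := fun o => o.elim sᶜ fun i => B i ∩ s)
      (T := fun o => o.elim {0} T)
      (by rintro (_ | i); exacts [hs.compl, (hB i).inter hs])
      (by
        rintro (_ | i) (_ | j) hij
        · exact absurd rfl hij
        · exact disjoint_compl_left.mono_right Set.inter_subset_right
        · exact disjoint_compl_right.mono_left Set.inter_subset_right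
        · exact (hd fun h => hij (congrArg some h)).mono Set.inter_subset_left
            Set.inter_subset_left)
      (by rintro (_ | i); exacts [measurableSet_singleton 0, hT i])
    rw [Fintype.prod_option] at h2
    simp only [Option.elim] at h2
    rw [← h1] at h2
    simp only [Option.forall, Set.mem_singleton_iff] at h2
    convert h2 using 2
    · ext ω
      simp only [coe_restrict, Measure.restrict_apply (hB _), Set.mem_inter_iff, Set.mem_preimage,
        Set.mem_ofPred_eq, and_comm]
    · congr 1
      ext ω
      simp only [coe_restrict, Measure.restrict_apply (hB _), Set.mem_preimage,
        Set.mem_ofPred_eq]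
  have h := congrArg (fun m => m A) key
  simp only [Measure.map_apply hr hA, Measure.restrict_apply (hr hA), Measure.smul_apply,
    smul_eq_mul] at h
  refine Eq.trans ?_ h
  congr 1
  ext ω
  exact and_comm

end IsPoissonProcess
end

/-! ### The Mecke equation. -/

section

variable {X : Type*} [MeasurableSpace X] {R : LocalisingRing X}

namespace IsPoissonProcess

open CountingMeasure

variable {Ω : Type*} [MeasurableSpace Ω] {P : Measure Ω} {ν : Measure X}
  {η : Ω → CountingMeasure R}

theorem setLIntegral_apply (hη : IsPoissonProcess P ν η) {B : Set X} (hB : B ∈ R.sets)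
    (S : Set Ω) :
    ∫⁻ ω in S, (η ω).1 B ∂P = ∑' k : ℕ, (k : ℝ≥0∞) * P (S ∩ {ω | (η ω).1 B = k}) := by
  classical
  have hm : ∀ k : ℕ, MeasurableSet {ω | (η ω).1 B = k} := fun k =>
    hη.measurable_apply (R.measurableSet B hB) (measurableSet_singleton _)
  have h : ∀ ω, (η ω).1 B =
      ∑' k : ℕ, {ω | (η ω).1 B = k}.indicator (fun _ => (k : ℝ≥0∞)) ω := by
    intro ω
    obtain ⟨l, hl⟩ := (η ω).2 B hB
    rw [tsum_eq_single l]
    · simp [hl]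
    · intro k hk
      simp [hl, hk.symm]
  rw [lintegral_congr h, lintegral_tsum fun k => (measurable_const.indicator (hm k)).aemeasurable]
  refine tsum_congr fun k => ?_
  rw [lintegral_indicator_const (hm k), Measure.restrict_apply (hm k), Set.inter_comm]

theorem add_one_mul_prob_eq (hη : IsPoissonProcess P ν η) {B : Set X} (hB : MeasurableSet B)
    (k : ℕ) :
    ((k + 1 : ℕ) : ℝ≥0∞) * P {ω | (η ω).1 B = (k + 1 : ℕ)} = ν B * P {ω | (η ω).1 B = k} := by
  rw [hη.prob_eq B hB, hη.prob_eq B hB, Nat.factorial_succ, Nat.cast_mul, pow_succ,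
    ENNReal.div_eq_inv_mul, ENNReal.div_eq_inv_mul, ENNReal.mul_inv (by simp) (by simp)]
  have : ((k + 1 : ℕ) : ℝ≥0∞) * ((k + 1 : ℕ) : ℝ≥0∞)⁻¹ = 1 :=
    ENNReal.mul_inv_cancel (by simp) (by simp)
  calc
    _ = ((k + 1 : ℕ) : ℝ≥0∞) * ((k + 1 : ℕ) : ℝ≥0∞)⁻¹ *
        (ν B * ((k.factorial : ℝ≥0∞)⁻¹ * (expNeg (ν B) * ν B ^ k))) := by ring
    _ = _ := by rw [this, one_mul]

/-- The Mecke equation for one Poisson variable `N` of mean `c`: `E[N; N ∈ T] = c P(N + 1 ∈ T)`. The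
term `k = 0` vanishes and the rest shifts by one through `add_one_mul_prob_eq`. -/
theorem tsum_mul_prob (hη : IsPoissonProcess P ν η) {B : Set X} (hB : B ∈ R.sets)
    {T : Set ℝ≥0∞} (hT : MeasurableSet T) :
    ∑' k : ℕ, (k : ℝ≥0∞) * P {ω | (η ω).1 B ∈ T ∩ {(k : ℝ≥0∞)}} =
      ν B * P {ω | (η ω).1 B ∈ (fun t => t + 1) ⁻¹' T} := by
  classical
  have hBm := R.measurableSet B hB
  have hm : ∀ k : ℕ, MeasurableSet {ω | (η ω).1 B = k} := fun k =>
    hη.measurable_apply hBm (measurableSet_singleton _)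
  have h1 : ∀ (U : Set ℝ≥0∞) (k : ℕ), P {ω | (η ω).1 B ∈ U ∩ {(k : ℝ≥0∞)}} =
      if (k : ℝ≥0∞) ∈ U then P {ω | (η ω).1 B = k} else 0 := by
    intro U k
    split_ifs with h
    · congr 1
      ext ω
      simp only [Set.mem_inter_iff, Set.mem_singleton_iff, Set.mem_ofPred_eq, and_iff_right_iff_imp]
      rintro h'
      rwa [h']
    · convert measure_empty (μ := P)
      ext ω
      simp only [Set.mem_inter_iff, Set.mem_singleton_iff, Set.mem_ofPred_eq,
        Set.mem_empty_iff_false, iff_false, not_and]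
      rintro h' h''
      rw [h''] at h'
      exact h h'
  have h2 : P {ω | (η ω).1 B ∈ (fun t => t + 1) ⁻¹' T} =
      ∑' k : ℕ, P {ω | (η ω).1 B ∈ (fun t => t + 1) ⁻¹' T ∩ {(k : ℝ≥0∞)}} := by
    have hU : MeasurableSet ((fun t : ℝ≥0∞ => t + 1) ⁻¹' T) := (measurable_id.add_const 1) hT
    rw [← measure_iUnion]
    · congr 1
      ext ω
      obtain ⟨l, hl⟩ := (η ω).2 B hB
      simp [hl]
    · intro k l hkl
      rw [Function.onFun, Set.disjoint_left]
      intro ω hk hl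
      have : (k : ℝ≥0∞) = l := (show _ = _ from hk.2).symm.trans hl.2
      exact hkl (by exact_mod_cast this)
    · exact fun k => hη.measurable_apply hBm (hU.inter (measurableSet_singleton _))
  rw [tsum_eq_zero_add' ENNReal.summable, h2, ← ENNReal.tsum_mul_left]
  simp only [Nat.cast_zero, zero_mul, zero_add]
  refine tsum_congr fun k => ?_
  rw [h1, h1]
  have : ((k + 1 : ℕ) : ℝ≥0∞) ∈ T ↔ (k : ℝ≥0∞) ∈ (fun t => t + 1) ⁻¹' T := by
    simp
  simp only [this]
  split_ifs
  · exact hη.add_one_mul_prob_eq hBm k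
  · simp

/-- Adding a point of `B i` raises only the count of that cell, so independence reduces the claim to
the one-variable identity. -/
theorem setLIntegral_apply_partition (hη : IsPoissonProcess P ν η) {ι : Type*} [Fintype ι]
    [DecidableEq ι]
    {B : ι → Set X} (hB : ∀ i, MeasurableSet (B i)) (hd : Pairwise fun i j => Disjoint (B i) (B j))
    {T : ι → Set ℝ≥0∞} (hT : ∀ i, MeasurableSet (T i)) {i : ι} (hi : B i ∈ R.sets) :
    ∫⁻ ω in {ω | ∀ j, (η ω).1 (B j) ∈ T j}, (η ω).1 (B i) ∂P =
      ∫⁻ x in B i, P {ω | ∀ j, (η ω + dirac R x).1 (B j) ∈ T j} ∂ν := by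
  have hprod : ∀ U : Set ℝ≥0∞, MeasurableSet U →
      P {ω | ∀ j, (η ω).1 (B j) ∈ Function.update T i U j} =
        P {ω | (η ω).1 (B i) ∈ U} * ∏ j ∈ Finset.univ.erase i, P {ω | (η ω).1 (B j) ∈ T j} := by
    intro U hU
    rw [hη.prob_forall_mem hB hd, ← Finset.mul_prod_erase _ _ (Finset.mem_univ i)]
    · rw [Function.update_self]
      congr 1
      refine Finset.prod_congr rfl fun j hj => ?_
      rw [Function.update_of_ne (Finset.ne_of_mem_erase hj)]
    · intro j
      by_cases h : j = i
      · subst h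
        simpa using hU
      · simpa [Function.update_of_ne h] using hT j
  have hset : ∀ k : ℕ, {ω | ∀ j, (η ω).1 (B j) ∈ T j} ∩ {ω | (η ω).1 (B i) = k} =
      {ω | ∀ j, (η ω).1 (B j) ∈ Function.update T i (T i ∩ {(k : ℝ≥0∞)}) j} := by
    intro k
    ext ω
    simp only [Set.mem_inter_iff, Set.mem_ofPred_eq]
    constructor
    · rintro ⟨h1, h2⟩ j
      by_cases h : j = i
      · subst h
        simpa using ⟨h1 j, h2⟩
      · simpa [Function.update_of_ne h] using h1 j
    · intro h1
      have h2 := h1 i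
      simp only [Function.update_self] at h2
      refine ⟨fun j => ?_, h2.2⟩
      by_cases h : j = i
      · subst h
        exact h2.1
      · simpa [Function.update_of_ne h] using h1 j
  have hset' : ∀ x ∈ B i, {ω | ∀ j, (η ω + dirac R x).1 (B j) ∈ T j} =
      {ω | ∀ j, (η ω).1 (B j) ∈ Function.update T i ((fun t => t + 1) ⁻¹' T i) j} := by
    intro x hx
    ext ω
    refine forall_congr' fun j => ?_
    by_cases h : j = i
    · subst h
      simp [Measure.dirac_apply_of_mem hx]
    · have hxj : x ∉ B j := Set.disjoint_left.1 (hd (Ne.symm h)) hx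
      simp [Function.update_of_ne h, Measure.dirac_apply' _ (hB j), hxj]
  have hU : MeasurableSet ((fun t : ℝ≥0∞ => t + 1) ⁻¹' T i) := (measurable_id.add_const 1) (hT i)
  rw [hη.setLIntegral_apply hi, setLIntegral_congr_fun (hB i) fun x hx => by rw [hset' x hx],
    lintegral_const, Measure.restrict_apply_univ, hprod _ hU]
  simp only [hset]
  rw [tsum_congr fun k => by rw [hprod _ ((hT i).inter (measurableSet_singleton _)), ← mul_assoc],
    ENNReal.tsum_mul_right, hη.tsum_mul_prob hi (hT i)]
  ring

theorem setLIntegral_apply_eq [StandardBorelSpace X] [SFinite ν] (hη : IsPoissonProcess P ν η)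
    {C : Set X} (hC : C ∈ R.sets) (hν : ν C < ∞) {A : Set (CountingMeasure R)}
    (hA : MeasurableSet A) :
    ∫⁻ ω in η ⁻¹' A, (η ω).1 C ∂P = ∫⁻ x in C, P {ω | η ω + dirac R x ∈ A} ∂ν := by
  have := hη.isProbabilityMeasure
  have hCm := R.measurableSet C hC
  have hadd : Measurable fun p : X × Ω => η p.2 + dirac R p.1 :=
    measurable_add (hη.measurable.comp measurable_snd) (measurable_dirac.comp measurable_fst)
  have hQ : ∀ {S : Set (CountingMeasure R)}, MeasurableSet S →
      ((P.withDensity fun ω => (η ω).1 C).map η) S = ∫⁻ ω in η ⁻¹' S, (η ω).1 C ∂P := by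
    intro S hS
    rw [Measure.map_apply hη.measurable hS, withDensity_apply _ (hη.measurable hS)]
  have hQ' : ∀ {S : Set (CountingMeasure R)}, MeasurableSet S →
      (((ν.restrict C).prod P).map fun p : X × Ω => η p.2 + dirac R p.1) S =
        ∫⁻ x in C, P {ω | η ω + dirac R x ∈ S} ∂ν := by
    intro S hS
    rw [Measure.map_apply hadd hS, Measure.prod_apply (hadd hS)]
    rfl
  have hfin : IsFiniteMeasure ((ν.restrict C).prod P) := by
    have : IsFiniteMeasure (ν.restrict C) := ⟨by simpa using hν⟩
    infer_instance
  -- Both sides are measures in `A`, so partitions compatible with `C` suffice; cells disjoint from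
  -- `C` contribute zero.
  have key : (((ν.restrict C).prod P).map fun p : X × Ω => η p.2 + dirac R p.1) =
      (P.withDensity fun ω => (η ω).1 C).map η := by
    refine ext_of_partition hCm fun ι _ _ B hB hd hU hBC T hT => ?_
    rw [hQ (measurableSet_forall_mem hB hT), hQ' (measurableSet_forall_mem hB hT)]
    have hdC : Pairwise (fun i j => Disjoint (C ∩ B i) (C ∩ B j)) :=
      fun i j hij => (hd hij).mono Set.inter_subset_right Set.inter_subset_right
    have hCU : C = ⋃ i, C ∩ B i := by
      rw [← Set.inter_iUnion, hU, Set.inter_univ]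
    have h1 : ∀ ω, (η ω).1 C = ∑ i, (η ω).1 (C ∩ B i) := by
      intro ω
      conv_lhs => rw [hCU]
      rw [measure_iUnion hdC fun i => hCm.inter (hB i), tsum_fintype]
    rw [lintegral_congr h1, lintegral_finsetSum _ fun i _ =>
      hη.measurable_apply (hCm.inter (hB i))]
    conv_lhs => rw [hCU]
    rw [lintegral_iUnion (fun i => hCm.inter (hB i)) hdC, tsum_fintype]
    refine Finset.sum_congr rfl fun i _ => ?_
    rcases hBC i with h | h
    · have hi : B i ∈ R.sets := by
        have := R.inter_mem _ hC _ (hB i)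
        rwa [Set.inter_eq_right.2 h] at this
      rw [Set.inter_eq_right.2 h]
      exact (hη.setLIntegral_apply_partition hB hd hT hi).symm
    · rw [Set.disjoint_iff_inter_eq_empty.1 h.symm]
      simp
  rw [← hQ hA, ← hQ' hA, key]

/-- The Mecke equation. -/
theorem lintegral_lintegral_eq [StandardBorelSpace X] (hη : IsPoissonProcess P ν η)
    (hν : IsLocFinite R ν) {f : X → CountingMeasure R → ℝ≥0∞}
    (hf : Measurable (Function.uncurry f)) :
    ∫⁻ ω, ∫⁻ y, f y (η ω) ∂(η ω).1 ∂P = ∫⁻ y, ∫⁻ ω, f y (η ω + dirac R y) ∂P ∂ν := by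
  have := hη.isProbabilityMeasure
  have := hν.sigmaFinite
  obtain ⟨E, hE, -, hU⟩ := R.exists_disjoint_cover
  have hEm := fun n => R.measurableSet _ (hE n)
  have hadd : Measurable fun p : X × Ω => ((η p.2 + dirac R p.1, p.1) : CountingMeasure R × X) :=
    (measurable_add (hη.measurable.comp measurable_snd)
      (measurable_dirac.comp measurable_fst)).prodMk measurable_fst
  -- The left side is the Campbell measure. Equality is checked on rectangles within each strip over
  -- `E n`, where the measures are finite.
  have key : (P.map η) ⊗ₘ (toKernel R) = (ν.prod P).map fun p => (η p.2 + dirac R p.1, p.1) := by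
    rw [Measure.ext_iff_of_iUnion_eq_univ
      (s := fun n => (Set.univ : Set (CountingMeasure R)) ×ˢ E n)
      (by rw [← Set.prod_iUnion, hU, Set.univ_prod_univ])]
    intro n
    have hprod : ∀ {S : Set (CountingMeasure R)} {C : Set X}, MeasurableSet S → MeasurableSet C →
        ((ν.prod P).map fun p => (η p.2 + dirac R p.1, p.1)).restrict (Set.univ ×ˢ E n) (S ×ˢ C)
          = ∫⁻ x in C ∩ E n, P {ω | η ω + dirac R x ∈ S} ∂ν := by
      intro S C hS hC
      rw [Measure.restrict_apply (hS.prod hC), Set.prod_inter_prod, Set.inter_univ,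
        Measure.map_apply hadd (hS.prod (hC.inter (hEm n))),
        Measure.prod_apply (hadd (hS.prod (hC.inter (hEm n)))),
        ← lintegral_indicator (hC.inter (hEm n))]
      refine lintegral_congr fun x => ?_
      classical
      rw [Set.indicator_apply]
      split_ifs with hx
      · congr 1
        ext ω
        simpa using fun _ => hx
      · convert measure_empty (μ := P)
        ext ω
        simpa using fun _ => by simpa using hx
    have hfin : IsFiniteMeasure
        (((ν.prod P).map fun p => (η p.2 + dirac R p.1, p.1)).restrict (Set.univ ×ˢ E n)) := by
      refine ⟨?_⟩
      rw [← Set.univ_prod_univ, hprod MeasurableSet.univ MeasurableSet.univ]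
      simpa using hν _ (hE n)
    refine (Measure.ext_prod fun {S C} hS hC => ?_).symm
    rw [hprod hS hC, Measure.restrict_apply (hS.prod hC), Set.prod_inter_prod, Set.inter_univ,
      Measure.compProd_apply_prod hS (hC.inter (hEm n))]
    have hmem : C ∩ E n ∈ R.sets := by
      rw [Set.inter_comm]
      exact R.inter_mem _ (hE n) C hC
    rw [← hη.setLIntegral_apply_eq hmem (hν _ hmem) hS,
      setLIntegral_map hS (Kernel.measurable_coe _ (hC.inter (hEm n))) hη.measurable]
    rfl
  have hf' : Measurable fun p : CountingMeasure R × X => f p.2 p.1 := hf.comp measurable_swap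
  have h := congrArg (fun m => ∫⁻ p, f p.2 p.1 ∂m) key
  simp only [Measure.lintegral_compProd hf', lintegral_map hf' hadd, toKernel_apply] at h
  have hm : Measurable fun μ : CountingMeasure R => ∫⁻ y, f y μ ∂μ.1 :=
    measurable_lintegral measurable_id (f := fun μ y => f y μ) hf'
  rw [lintegral_map hm hη.measurable] at h
  exact h.trans (lintegral_prod _ (hf'.comp hadd).aemeasurable)

end IsPoissonProcess
end

/-! ### Iterated Mecke equation and the joint law. -/

section

variable {X : Type*} [MeasurableSpace X] {R : LocalisingRing X}

open CountingMeasure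

variable {Ω : Type*} [MeasurableSpace Ω] {P : Measure Ω} {ν : Measure X}
  {η : Ω → CountingMeasure R} {D : CountingMeasure R → CountingMeasure R}

theorem lintegral_pi_succ [SigmaFinite ν] {k : ℕ} {f : (Fin (k + 1) → X) → ℝ≥0∞}
    (hf : Measurable f) :
    ∫⁻ x, f x ∂Measure.pi (fun _ => ν) =
      ∫⁻ x, ∫⁻ y, f (Fin.cons y x) ∂ν ∂Measure.pi (fun _ : Fin k => ν) := by
  have h := (measurePreserving_piFinSuccAbove (fun _ : Fin (k + 1) => ν) 0).symm
  rw [← h.lintegral_comp hf]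
  refine (lintegral_prod_symm _ (hf.comp h.measurable).aemeasurable).trans ?_
  refine lintegral_congr fun x => lintegral_congr fun y => ?_
  simp [MeasurableEquiv.piFinSuccAbove_symm_apply, Fin.insertNthEquiv]

variable [StandardBorelSpace X]

/-- Iterated Mecke equation for ordered `k`-tuples of points chosen by the generator. -/
theorem IsPoissonProcess.lintegral_lintegral_diracSum_le (hη : IsPoissonProcess P ν η)
    (hν : IsLocFinite R ν) (hD : IsGenerator D) (n : ℕ) {f : CountingMeasure R → ℝ≥0∞}
    (hf : Measurable f) (hfn : ∀ μ, f μ ≠ 0 → (D μ).1 Set.univ = n) (k : ℕ) :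
    ∫⁻ x, ∫⁻ ω, {μ | diracSum R x ≤ D μ}.indicator f (η ω + diracSum R x) ∂P
        ∂Measure.pi (fun _ : Fin k => ν) =
      n.descFactorial k * ∫⁻ ω, f (η ω) ∂P := by
  have := hν.sigmaFinite
  have := hη.isProbabilityMeasure
  induction k with
  | zero =>
    have h0 : ∀ (x : Fin 0 → X) (μ : CountingMeasure R),
        {μ | diracSum R x ≤ D μ}.indicator f (μ + diracSum R x) = f μ := by
      intro x μ
      have hz : diracSum R x = zero := Subtype.ext (by simp [zero])
      rw [hz, add_zero', Set.indicator_of_mem]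
      intro s
      simp [zero]
    simp [h0]
  | succ k ih =>
    have hmeas : ∀ m : ℕ, Measurable fun p : (Fin m → X) × CountingMeasure R =>
        {μ | diracSum R p.1 ≤ D μ}.indicator f p.2 := fun m =>
      (hf.comp measurable_snd).indicator
        (s := {p : (Fin m → X) × CountingMeasure R | diracSum R p.1 ≤ D p.2})
        (measurableSet_diracSum_le measurable_fst (hD.measurable.comp measurable_snd))
    have hshift : ∀ m : ℕ, Measurable fun p : (Fin m → X) × Ω =>
        (p.1, η p.2 + diracSum R p.1) := fun m =>
      measurable_fst.prodMk (measurable_add (hη.measurable.comp measurable_snd)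
        (measurable_diracSum.comp measurable_fst))
    have hint : ∀ m : ℕ, Measurable fun x : Fin m → X =>
        ∫⁻ ω, {μ | diracSum R x ≤ D μ}.indicator f (η ω + diracSum R x) ∂P := fun m =>
      ((hmeas m).comp (hshift m)).lintegral_prod_right'
    rw [lintegral_pi_succ (hint (k + 1)),
      Nat.descFactorial_succ, Nat.cast_mul, mul_assoc, ← ih,
      ← lintegral_const_mul _ (hint k)]
    refine lintegral_congr fun x => ?_
    have hcons : Measurable fun p : X × CountingMeasure R =>
        ((Fin.cons p.1 x, p.2 + diracSum R x) : (Fin (k + 1) → X) × CountingMeasure R) := by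
      refine Measurable.prodMk (measurable_pi_iff.2 fun i => ?_)
        (measurable_add measurable_snd measurable_const)
      refine Fin.cases ?_ (fun j => ?_) i
      · simpa using measurable_fst
      · simp
    have hG : Measurable fun p : X × CountingMeasure R =>
        {κ | diracSum R (Fin.cons p.1 x : Fin (k + 1) → X) ≤ D κ}.indicator f
          (p.2 + diracSum R x) := by
      have h := (hmeas (k + 1)).comp hcons
      simp only [Function.comp_def] at h
      exact h
    -- The Mecke equation is applied to the new point `y` alone, with the tuple `x` frozen as a
    -- shift of `η`.
    have hM := hη.lintegral_lintegral_eq hν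
      (f := fun y μ => {κ | diracSum R (Fin.cons y x : Fin (k + 1) → X) ≤ D κ}.indicator f
        (μ + diracSum R x)) hG
    have hre : ∀ y ω, η ω + dirac R y + diracSum R x =
        η ω + diracSum R (Fin.cons y x : Fin (k + 1) → X) := by
      intro y ω
      rw [diracSum_cons, CountingMeasure.add_right_comm', ← CountingMeasure.add_assoc']
    simp only [hre] at hM
    have hsec : Measurable fun ω =>
        {μ | diracSum R x ≤ D μ}.indicator f (η ω + diracSum R x) :=
      (hf.indicator (measurableSet_diracSum_le measurable_const hD.measurable)).comp
        (measurable_add hη.measurable measurable_const)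
    rw [← hM, ← lintegral_const_mul _ hsec]
    refine lintegral_congr fun ω => ?_
    have hcongr : ∀ y, {κ | diracSum R (Fin.cons y x : Fin (k + 1) → X) ≤ D κ}.indicator f
        (η ω + diracSum R x) =
        {y | diracSum R x + dirac R y ≤ D (η ω + diracSum R x)}.indicator
          (fun _ => f (η ω + diracSum R x)) y := by
      intro y
      classical
      simp only [Set.indicator_apply, Set.mem_ofPred_eq, diracSum_cons]
    have hSm : MeasurableSet {y | diracSum R x + dirac R y ≤ D (η ω + diracSum R x)} := by
      have h := measurableSet_diracSum_le (R := R) (x := fun y => (Fin.cons y x : Fin (k + 1) → X))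
        (measurable_fst.comp (hcons.comp (measurable_prodMk_right (y := η ω))))
        (measurable_const (a := D (η ω + diracSum R x)))
      simpa only [diracSum_cons] using h
    rw [lintegral_congr hcongr, lintegral_indicator_const hSm, mul_comm]
    -- The selection is known to have `n` points only where `f` does not vanish.
    by_cases hf0 : f (η ω + diracSum R x) = 0
    · rw [hf0, mul_zero]
      classical
      simp [Set.indicator_apply, hf0]
    by_cases hle : diracSum R x ≤ D (η ω + diracSum R x)
    · rw [Set.indicator_of_mem (show _ ∈ {μ | diracSum R x ≤ D μ} from hle)]
      congr 1
      -- Of the `n` selected points `k` are taken by `x`, leaving `n - k` candidates, the next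
      -- factor of the falling factorial.
      have hc := hD.apply_setOf_add_dirac_le hle
      rw [hfn _ hf0, diracSum_univ] at hc
      rw [ENNReal.natCast_sub]
      exact ENNReal.eq_sub_of_add_eq (by simp) hc
    · rw [Set.indicator_of_notMem (show _ ∉ {μ | diracSum R x ≤ D μ} from hle), mul_zero]
      convert zero_mul _
      convert measure_empty (μ := (η ω).1)
      ext y
      simp only [Set.mem_ofPred_eq, Set.mem_empty_iff_false, iff_false]
      exact fun h => hle ((le_add_right' _ _).trans h)

/-- The joint distribution of the selected points and of the points in their hull. -/
theorem IsPoissonProcess.factorial_mul_lintegral (hη : IsPoissonProcess P ν η)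
    (hν : IsLocFinite R ν) (hD : IsGenerator D) (n : ℕ)
    {A : Set (CountingMeasure R × CountingMeasure R)} (hA : MeasurableSet A) :
    n.factorial * P {ω | (D (η ω)).1 Set.univ = n ∧ (D (η ω), (η ω).restrict (hull D (η ω))) ∈ A} =
      ∫⁻ x in fixedTuples D n, expNeg (ν (hull D (diracSum R x))ᶜ) *
        P {ω | (diracSum R x, (η ω).restrict (hull D (diracSum R x))) ∈ A}
        ∂Measure.pi (fun _ : Fin n => ν) := by
  have := hν.sigmaFinite
  have := hη.isProbabilityMeasure
  have hres : Measurable fun μ : CountingMeasure R => (D μ, μ.restrict (hull D μ)) :=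
    hD.measurable.prodMk
      (measurable_restrict_of_prod measurable_id (measurableSet_mem_hull hD.measurable))
  set S : Set (CountingMeasure R) :=
    {μ | (D μ).1 Set.univ = n ∧ (D μ, μ.restrict (hull D μ)) ∈ A} with hS
  have hSm : MeasurableSet S :=
    ((CountingMeasure.measurable_apply MeasurableSet.univ).comp hD.measurable
      (measurableSet_singleton _)).inter (hres hA)
  have h := hη.lintegral_lintegral_diracSum_le hν hD n (f := S.indicator 1)
    (measurable_one.indicator hSm)
    (fun μ hμ => (Set.mem_of_indicator_ne_zero hμ).1) n
  have h0 : ∫⁻ ω, S.indicator 1 (η ω) ∂P = P {ω | η ω ∈ S} := by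
    rw [← lintegral_map (measurable_one.indicator hSm) hη.measurable, lintegral_indicator_one hSm,
      Measure.map_apply hη.measurable hSm]
    rfl
  rw [Nat.descFactorial_self, h0] at h
  refine h.symm.trans ?_
  rw [← lintegral_indicator (measurableSet_fixedTuples hD.measurable n)]
  refine lintegral_congr fun x => ?_
  -- For fixed `x` the event separates into a condition on `x`, emptiness of `η` off `[x]`, and an
  -- event for `η` on `[x]`.
  have hiff : ∀ ω, (η ω + diracSum R x ∈ {μ | diracSum R x ≤ D μ} ∩ S) ↔
      x ∈ fixedTuples D n ∧ (η ω).1 (hull D (diracSum R x))ᶜ = 0 ∧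
        (η ω).restrict (hull D (diracSum R x)) ∈ {μ | (diracSum R x, μ) ∈ A} := by
    intro ω
    have hx := hD.apply_add_eq_iff (μ := diracSum R x) (ν := η ω) (by simp)
    constructor
    · rintro ⟨h1, h2, h3⟩
      have h4 : D (η ω + diracSum R x) = diracSum R x :=
        (eq_of_le_of_univ_le h1 (by rw [h2, diracSum_univ]) (by rw [h2]; simp)).symm
      obtain ⟨h5, h6⟩ := hx.1 h4
      refine ⟨h5, h6, ?_⟩
      rwa [hD.restrict_hull_add h4, h4] at h3
    · rintro ⟨h5, h6, h3⟩
      have h4 := hx.2 ⟨h5, h6⟩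
      refine ⟨h4.ge, ?_, ?_⟩
      · rw [h4, diracSum_univ]
      · rw [hD.restrict_hull_add h4, h4]
        exact h3
  have hsec : MeasurableSet {μ : CountingMeasure R | (diracSum R x, μ) ∈ A} :=
    measurable_prodMk_left hA
  have hhull := measurableSet_hull hD.measurable (diracSum R x)
  have hleft : ∫⁻ ω, {μ | diracSum R x ≤ D μ}.indicator (S.indicator 1) (η ω + diracSum R x) ∂P =
      P {ω | η ω + diracSum R x ∈ {μ | diracSum R x ≤ D μ} ∩ S} := by
    rw [Set.indicator_indicator]
    have hm : MeasurableSet ({μ | diracSum R x ≤ D μ} ∩ S) :=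
      (measurableSet_diracSum_le measurable_const hD.measurable).inter hSm
    have ha : Measurable fun ω => η ω + diracSum R x := measurable_add hη.measurable measurable_const
    rw [← lintegral_map (measurable_one.indicator hm) ha, lintegral_indicator_one hm,
      Measure.map_apply ha hm]
    rfl
  rw [hleft]
  simp only [hiff]
  by_cases hx : x ∈ fixedTuples D n
  · rw [Set.indicator_of_mem hx]
    refine Eq.trans ?_ (hη.prob_compl_eq_zero_inter hhull hsec)
    simp [hx]
  · rw [Set.indicator_of_notMem hx]
    simp [hx]

end

/-! ### Fubini form of the joint law and disintegration over the selected points. -/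

theorem measurable_expNeg : Measurable expNeg :=
  EReal.measurable_exp.comp (measurable_coe_ennreal_ereal.neg)

section

variable {X : Type*} [MeasurableSpace X] [StandardBorelSpace X] {R : LocalisingRing X}

open CountingMeasure

variable {Ω : Type*} [MeasurableSpace Ω] {P : Measure Ω} {ν : Measure X}
  {η : Ω → CountingMeasure R} {D : CountingMeasure R → CountingMeasure R}

theorem measurable_expNeg_compl_hull [SFinite ν] (hD : Measurable D) (n : ℕ) :
    Measurable fun x : Fin n → X => expNeg (ν (hull D (diracSum R x))ᶜ) := by
  have hs : MeasurableSet {p : (Fin n → X) × X | p.2 ∈ hull D (diracSum R p.1)}ᶜ :=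
    ((measurable_diracSum.comp measurable_fst).prodMk measurable_snd
      (measurableSet_mem_hull hD)).compl
  exact measurable_expNeg.comp (measurable_measure_prodMk_left hs)

theorem IsPoissonProcess.prob_eq_lintegral (hη : IsPoissonProcess P ν η)
    (hν : IsLocFinite R ν) (hD : IsGenerator D) (n : ℕ)
    {A : Set (CountingMeasure R × CountingMeasure R)} (hA : MeasurableSet A) :
    P {ω | (D (η ω)).1 Set.univ = n ∧ (D (η ω), (η ω).restrict (hull D (η ω))) ∈ A} =
      (n.factorial : ℝ≥0∞)⁻¹ * ∫⁻ ω, (∫⁻ x in fixedTuples D n,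
        A.indicator 1 (diracSum R x, (η ω).restrict (hull D (diracSum R x))) *
          expNeg (ν (hull D (diracSum R x))ᶜ) ∂(Measure.pi fun _ : Fin n => ν)) ∂P := by
  have := hν.sigmaFinite
  have := hη.isProbabilityMeasure
  have hpair : Measurable fun p : Ω × (Fin n → X) =>
      (diracSum R p.2, (η p.1).restrict (hull D (diracSum R p.2))) := by
    refine (measurable_diracSum.comp measurable_snd).prodMk
      (measurable_restrict_of_prod (hη.measurable.comp measurable_fst) ?_)
    exact ((measurable_diracSum.comp (measurable_snd.comp measurable_fst)).prodMk measurable_snd)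
      (measurableSet_mem_hull hD.measurable)
  have hind : Measurable fun p : Ω × (Fin n → X) => A.indicator
      (1 : CountingMeasure R × CountingMeasure R → ℝ≥0∞)
      (diracSum R p.2, (η p.1).restrict (hull D (diracSum R p.2))) :=
    (measurable_one.indicator hA).comp hpair
  have hswap := lintegral_lintegral_swap (μ := P)
    (ν := (Measure.pi fun _ : Fin n => ν).restrict (fixedTuples D n))
    (f := fun ω x => A.indicator 1 (diracSum R x, (η ω).restrict (hull D (diracSum R x))) *
          expNeg (ν (hull D (diracSum R x))ᶜ))
    (hind.mul ((measurable_expNeg_compl_hull hD.measurable n).comp measurable_snd)).aemeasurable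
  have hprob : ∀ x : Fin n → X,
      ∫⁻ ω, A.indicator 1 (diracSum R x, (η ω).restrict (hull D (diracSum R x))) *
          expNeg (ν (hull D (diracSum R x))ᶜ) ∂P =
        expNeg (ν (hull D (diracSum R x))ᶜ) *
          P {ω | (diracSum R x, (η ω).restrict (hull D (diracSum R x))) ∈ A} := by
    intro x
    have hx : Measurable fun ω => (diracSum R x, (η ω).restrict (hull D (diracSum R x))) :=
      measurable_const.prodMk
        ((measurable_restrict (measurableSet_hull hD.measurable _)).comp hη.measurable)
    have hxi : Measurable fun ω => A.indicator
        (1 : CountingMeasure R × CountingMeasure R → ℝ≥0∞)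
        (diracSum R x, (η ω).restrict (hull D (diracSum R x))) :=
      (measurable_one.indicator hA).comp hx
    rw [lintegral_mul_const _ hxi, mul_comm,
      ← lintegral_map (measurable_one.indicator hA) hx, lintegral_indicator_one hA,
      Measure.map_apply hx hA]
    rfl
  rw [hswap, lintegral_congr hprob, ← hη.factorial_mul_lintegral hν hD n hA, ← mul_assoc,
    ENNReal.inv_mul_cancel (by simp [Nat.factorial_ne_zero]) (by simp), one_mul]

/-- The distribution of the selected points, for a given finite number of them. -/
theorem IsPoissonProcess.factorial_smul_map (hη : IsPoissonProcess P ν η)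
    (hν : IsLocFinite R ν) (hD : IsGenerator D) (n : ℕ) :
    (n.factorial : ℝ≥0∞) •
        (P.restrict {ω | (D (η ω)).1 Set.univ = n}).map (fun ω => D (η ω)) =
      (((Measure.pi fun _ : Fin n => ν).restrict (fixedTuples D n)).withDensity
        fun x => expNeg (ν (hull D (diracSum R x))ᶜ)).map (diracSum R) := by
  have := hη.isProbabilityMeasure
  have hDη : Measurable fun ω => D (η ω) := hD.measurable.comp hη.measurable
  ext H hH
  have h := hη.factorial_mul_lintegral hν hD n (A := H ×ˢ Set.univ) (hH.prod MeasurableSet.univ)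
  rw [Measure.smul_apply, Measure.map_apply hDη hH, Measure.restrict_apply (hDη hH), smul_eq_mul,
    Measure.map_apply measurable_diracSum hH, withDensity_apply _ (measurable_diracSum hH),
    ← lintegral_indicator (measurable_diracSum hH)]
  convert h using 2
  · congr 1
    ext ω
    simp [and_comm]
  · ext x
    by_cases hx : diracSum R x ∈ H <;> simp [hx]

/-- The conditional law is realised by restricting an independent copy of `η` to the hull, so its
measurability in `μ` follows from Fubini. -/
theorem IsPoissonProcess.measurable_prob_restrict_hull (hη : IsPoissonProcess P ν η)
    (hD : Measurable D) {A : Set (CountingMeasure R)} (hA : MeasurableSet A) :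
    Measurable fun μ => P {ω | (η ω).restrict (hull D μ) ∈ A} := by
  have := hη.isProbabilityMeasure
  have hm : Measurable fun p : CountingMeasure R × Ω => (η p.2).restrict (hull D p.1) :=
    measurable_restrict_of_prod (hη.measurable.comp measurable_snd)
      ((measurable_fst.comp measurable_fst).prodMk measurable_snd (measurableSet_mem_hull hD))
  exact measurable_measure_prodMk_left (hm hA)

theorem IsPoissonProcess.poissonLaw_restrict_hull_apply (hη : IsPoissonProcess P ν η)
    (hD : Measurable D) {A : Set (CountingMeasure R)} (hA : MeasurableSet A)
    (μ : CountingMeasure R) :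
    poissonLaw R (ν.restrict (hull D μ)) A = P {ω | (η ω).restrict (hull D μ) ∈ A} := by
  have h := hη.restrict (measurableSet_hull hD μ)
  rw [h.poissonLaw_eq, Measure.map_apply h.measurable hA]
  rfl

/-- Disintegration of the points in the hull with respect to the selected points. -/
theorem IsPoissonProcess.setLIntegral_prob_restrict_hull (hη : IsPoissonProcess P ν η)
    (hν : IsLocFinite R ν) (hD : IsGenerator D) (hfin : ∀ᵐ ω ∂P, (D (η ω)).1 Set.univ < ∞)
    {A G : Set (CountingMeasure R)} (hA : MeasurableSet A) (hG : MeasurableSet G) :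
    ∫⁻ ω in {ω | D (η ω) ∈ G}, P {ω' | (η ω').restrict (hull D (D (η ω))) ∈ A} ∂P =
      P ({ω | (η ω).restrict (hull D (η ω)) ∈ A} ∩ {ω | D (η ω) ∈ G}) := by
  have := hη.isProbabilityMeasure
  have hDη : Measurable fun ω => D (η ω) := hD.measurable.comp hη.measurable
  set S : ℕ → Set Ω := fun n => {ω | (D (η ω)).1 Set.univ = n} with hS
  have hSm : ∀ n, MeasurableSet (S n) := fun n =>
    (CountingMeasure.measurable_apply MeasurableSet.univ).comp hDη (measurableSet_singleton _)
  have hSd : Pairwise (Function.onFun Disjoint S) := by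
    intro k l hkl
    rw [Function.onFun, Set.disjoint_left]
    intro ω hk hl
    have : (k : ℝ≥0∞) = l := (show _ = _ from hk).symm.trans hl
    exact hkl (by exact_mod_cast this)
  -- Almost sure finiteness of the selection enters here: the levels `S n` carry all of `P`.
  have hSU : P = P.restrict (⋃ n, S n) := by
    refine (Measure.restrict_eq_self_of_ae_mem ?_).symm
    filter_upwards [hfin] with ω hω
    rcases (D (η ω)).exists_enat_apply MeasurableSet.univ with h | ⟨k, hk⟩
    · exact absurd h hω.ne
    · exact Set.mem_iUnion.2 ⟨k, hk⟩
  have hq := hη.measurable_prob_restrict_hull hD.measurable hA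
  have hGm : MeasurableSet {ω | D (η ω) ∈ G} := hDη hG
  set F : CountingMeasure R → ℝ≥0∞ :=
    G.indicator fun μ => P {ω' | (η ω').restrict (hull D μ) ∈ A} with hF
  have hFm : Measurable F := hq.indicator hG
  have hl : ∫⁻ ω in {ω | D (η ω) ∈ G}, P {ω' | (η ω').restrict (hull D (D (η ω))) ∈ A} ∂P =
      ∑' n, ∫⁻ ω in S n, F (D (η ω)) ∂P := by
    rw [← lintegral_indicator hGm, ← lintegral_iUnion hSm hSd, ← hSU]
    rfl
  have hr : P ({ω | (η ω).restrict (hull D (η ω)) ∈ A} ∩ {ω | D (η ω) ∈ G}) =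
      ∑' n : ℕ, P {ω | (D (η ω)).1 Set.univ = n ∧
        (D (η ω), (η ω).restrict (hull D (η ω))) ∈ G ×ˢ A} := by
    have hres : Measurable fun ω => (η ω).restrict (hull D (η ω)) :=
      (measurable_restrict_of_prod measurable_id (measurableSet_mem_hull hD.measurable)).comp
        hη.measurable
    have hE : MeasurableSet ({ω | (η ω).restrict (hull D (η ω)) ∈ A} ∩ {ω | D (η ω) ∈ G}) :=
      (hres hA).inter hGm
    conv_lhs => rw [hSU]
    rw [Measure.restrict_apply hE, Set.inter_iUnion, measure_iUnion]
    · refine tsum_congr fun n => ?_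
      congr 1
      ext ω
      simp only [hS, Set.mem_inter_iff, Set.mem_ofPred_eq, Set.mem_prod]
      tauto
    · exact fun i j hij => (hSd hij).mono Set.inter_subset_right Set.inter_subset_right
    · exact fun n => hE.inter (hSm n)
  rw [hl, hr]
  refine tsum_congr fun n => ?_
  have hn0 : (n.factorial : ℝ≥0∞) ≠ 0 := by simp [Nat.factorial_ne_zero]
  -- After multiplication by `n!`, the right side comes from the joint law and the left from the law
  -- of the selection; both are the same integral over `fixedTuples`.
  rw [← ENNReal.mul_right_inj hn0 (by simp), hη.factorial_mul_lintegral hν hD n (hG.prod hA)]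
  have h := congrArg (fun m => ∫⁻ μ, F μ ∂m) (hη.factorial_smul_map hν hD n)
  have := hν.sigmaFinite
  simp only [lintegral_smul_measure, smul_eq_mul] at h
  rw [lintegral_map hFm hDη, lintegral_map hFm measurable_diracSum] at h
  refine (h.trans (lintegral_withDensity_eq_lintegral_mul _
    (measurable_expNeg_compl_hull hD.measurable n) (hFm.comp measurable_diracSum))).trans ?_
  refine lintegral_congr fun x => ?_
  by_cases hx : diracSum R x ∈ G <;> simp [hF, hx]

end

theorem theorem3p2 {X : Type*} [MeasurableSpace X] [StandardBorelSpace X]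
    (R : LocalisingRing X)
    {Ω : Type*} [MeasurableSpace Ω] (P : Measure Ω) [IsProbabilityMeasure P]
    (lam : Measure X) (hlam : IsLocFinite R lam)
    (η : Ω → CountingMeasure R) (hη : IsPoissonProcess P lam η)
    (D : CountingMeasure R → CountingMeasure R) (hD : IsGenerator D) :
    (∀ (n : ℕ) (A : Set (CountingMeasure R × CountingMeasure R)), MeasurableSet A →
      P {ω | (D (η ω)).1 Set.univ = n ∧ (D (η ω), (η ω).restrict (hull D (η ω))) ∈ A} =
        (n.factorial : ℝ≥0∞)⁻¹ *
          ∫⁻ ω, (∫⁻ x in fixedTuples D n,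
            A.indicator 1 (CountingMeasure.diracSum R x,
                (η ω).restrict (hull D (CountingMeasure.diracSum R x))) *
              expNeg (lam (hull D (CountingMeasure.diracSum R x))ᶜ)
            ∂(Measure.pi fun _ : Fin n => lam)) ∂P) ∧
    ((∀ᵐ ω ∂P, (D (η ω)).1 Set.univ < ∞) →
      ∀ A : Set (CountingMeasure R), MeasurableSet A →
        P⟦{ω | (η ω).restrict (hull D (η ω)) ∈ A} |
            MeasurableSpace.comap (fun ω => D (η ω)) inferInstance⟧
          =ᵐ[P] fun ω => (poissonLaw R (lam.restrict (hull D (η ω)))).real A) := by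
  refine ⟨fun n A hA => hη.prob_eq_lintegral hlam hD n hA, fun hfin A hA => ?_⟩
  have hDη : Measurable fun ω => D (η ω) := hD.measurable.comp hη.measurable
  have hq := hη.measurable_prob_restrict_hull hD.measurable hA
  -- Replacing the hull of `η` by that of `D η` exhibits the candidate as a function of `D η`, as
  -- conditioning on `D η` requires.
  have hlaw : (fun ω => (poissonLaw R (lam.restrict (hull D (η ω)))).real A) =
      fun ω => (P {ω' | (η ω').restrict (hull D (D (η ω))) ∈ A}).toReal := by
    funext ω
    rw [Measure.real, hη.poissonLaw_restrict_hull_apply hD.measurable hA, hD.hull_apply]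
  have hAm : MeasurableSet {ω | (η ω).restrict (hull D (η ω)) ∈ A} :=
    (CountingMeasure.measurable_restrict_of_prod measurable_id
      (CountingMeasure.measurableSet_mem_hull hD.measurable)).comp hη.measurable hA
  have hqm : Measurable fun ω => P {ω' | (η ω').restrict (hull D (D (η ω))) ∈ A} := hq.comp hDη
  rw [hlaw]
  refine (ae_eq_condExp_of_forall_setIntegral_eq hDη.comap_le ?_ ?_ ?_ ?_).symm
  · exact (integrable_const (1 : ℝ)).indicator hAm
  · intro s _ _
    refine Integrable.integrableOn (Integrable.of_bound hqm.ennreal_toReal.aestronglyMeasurable 1 ?_)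
    filter_upwards with ω
    rw [Real.norm_of_nonneg ENNReal.toReal_nonneg]
    exact measureReal_le_one
  · rintro _ ⟨G, hG, rfl⟩ _
    rw [integral_toReal hqm.aemeasurable (by filter_upwards with ω using measure_lt_top _ _),
      integral_indicator_const _ hAm, smul_eq_mul, mul_one, measureReal_restrict_apply hAm]
    exact congrArg ENNReal.toReal
      (hη.setLIntegral_prob_restrict_hull hlam hD hfin hA hG)
  · exact ((hq.ennreal_toReal.comp (comap_measurable _)).stronglyMeasurable).aestronglyMeasurable
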